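/- Let $N\ge 1$ be fixed. An instance of chores consists of a finite set $\mathcal M$ of items and additive utility functions $d_1,\dots,d_N$ on the subsets of $\mathcal M$ with values in $\mathbb R_{\le 0}$. An allocation is an ordered partition $S=(S_1,\dots,S_N)$ of $\mathcal M$ into $N$ (possibly empty) bundles. For an additive function $w$ on subsets of $\mathcal M$ put $$MmS^N_{w}(\mathcal M)=\max_{S}\min_{j} w(S_j),\qquad mMS^N_{w}(\mathcal M)=\min_{S}\max_{j} w(S_j),$$ where $S$ ranges over all allocations. An MmS allocation for $I=(d_i)_i$ is an allocation $S$ with $d_i(S_i)\ge MmS^N_{d_i}(\mathcal M)$ for all $i$. Let $\lambda^I$ be the least $\lambda\ge 0$ for which some allocation $S$ satisfies $d_i(S_i)\ge\lambda\, MmS^N_{d_i}(\mathcal M)$ for all $i$; an optimal MmS allocation is an allocation that satisfies this with $\lambda=\lambda^I$. Algorithm 2, given non-negative additive utilities $u=(u_i)_{i}$ (with $N$ agents) and $\varepsilon>0$: (1) select $\alpha,\beta>1$ with $\alpha\beta<1+\varepsilon$; (2) compute $c_i$ with $mMS^N_{u_i}(\mathcal M)\le c_i\le\alpha\, mMS^N_{u_i}(\mathcal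 M)$ for each $i$; (3) let $u_i'=u_i/c_i$ if $c_i>0$ and $u_i'=0$ if $c_i=0$; (4) compute an allocation $S$ with $u'_i(S_i)\le\beta\lambda^*$ for all $i$, where $\lambda^*=\min_{T}\max_i u_i'(T_i)$ over all allocations $T$, and return $S$. Then the following hold. (a) For every instance $I=(d_i)_i$ of chores with $N$ agents and every $\varepsilon>0$, every allocation $S$ that Algorithm 2 can return for $(-d_i)_i$ and $\varepsilon$ satisfies $d_i(S_i)\ge(1+\varepsilon)\lambda^I MmS^N_{d_i}(\mathcal M)$ for all $i$; and if $I$ has an MmS allocation, then also $d_i(S_i)\ge(1+\varepsilon)MmS^N_{d_i}(\mathcal M)$ for all $i$. (b) There is a program (depending only on $N$) which, given any instance $I=(d_i)_i$ of chores with $N$ agents and rational utilities and any rational $\varepsilon>0$, halts after executing Algorithm 2 for $(-d_i)_i$ and $\varepsilon$ (it returns $S$ together with $\alpha,\beta,c_1,\dots,c_N$), and whose running time is, for every fixed $\varepsilon$, bounded by a polynomial in the binary encoding length of $I$. Consequently, for a fixed number of agents, Algorithm 2 (executed for $-I$ and $\varepsilon$) is a polynomial-time approximation scheme (PTAS) for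 computing an optimal MmS allocation of chores, that is, it computes $S$ with $d_i(S_i)\ge(1+\varepsilon)\lambda^I MmS^N_{d_i}(\mathcal M)$ for all $i$; and on the instances that have an MmS allocation it is a PTAS for computing an MmS allocation, that is, it computes $S$ with $d_i(S_i)\ge(1+\varepsilon) MmS^N_{d_i}(\mathcal M)$ for all $i$. -/

import Mathlib

open Finset

/-! ### Fair allocation of indivisible items with additive utilities -/

/-- The values `v i j` that agent `i` assigns to the single items `j`.  An additive utility function
on sets of items is the same thing as its values on the items, see `utility`. -/
abbrev Utilities (N : ℕ) (M : Type*) := Fin N → M → ℝ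

/-- An ordered partition of the items into `N` (possibly empty) bundles: `S j` is the agent who
receives item `j`. -/
abbrev Allocation (N : ℕ) (M : Type*) := M → Fin N

/-- The bundle of agent `i`. -/
def Allocation.bundle {N : ℕ} {M : Type*} [Fintype M] (S : Allocation N M) (i : Fin N) : Finset M :=
  univ.filter fun j => S j = i

/-- The additive extension of item values `w` to sets of items. -/
noncomputable def utility {M : Type*} (w : M → ℝ) (T : Finset M) : ℝ := ∑ j ∈ T, w j

/-- All utilities are non-positive (the items are chores). -/
def IsNonpositive {N : ℕ} {M : Type*} (d : Utilities N M) : Prop := ∀ i j, d i j ≤ 0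

section Shares

variable {N : ℕ} [NeZero N] {M : Type*} [Fintype M] [DecidableEq M]

/-- The max-min share: the maximum over all `N`-partitions of the minimum value of a bundle. -/
noncomputable def maxMinShare (N : ℕ) [NeZero N] (w : M → ℝ) : ℝ :=
  univ.sup' univ_nonempty fun S : Allocation N M =>
    univ.inf' univ_nonempty fun i : Fin N => utility w (S.bundle i)

/-- The min-max share: the minimum over all `N`-partitions of the maximum value of a bundle. -/
noncomputable def minMaxShare (N : ℕ) [NeZero N] (w : M → ℝ) : ℝ :=
  univ.inf' univ_nonempty fun S : Allocation N M =>
    univ.sup' univ_nonempty fun i : Fin N => utility w (S.bundle i)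

/-- `S` solves the `lam`-max-min problem for the instance `v`. -/
def SolvesMaxMin (lam : ℝ) (v : Utilities N M) (S : Allocation N M) : Prop :=
  ∀ i, lam * maxMinShare N (v i) ≤ utility (v i) (S.bundle i)

/-- `S` is a max-min share allocation for the instance `v`. -/
def IsMmSAllocation (v : Utilities N M) (S : Allocation N M) : Prop :=
  ∀ i, maxMinShare N (v i) ≤ utility (v i) (S.bundle i)

/-- The optimal max-min share ratio of a non-positive instance: the least `lam ≥ 0` for which the
`lam`-max-min problem has a solution (the minimum is attained, see `isLeast_optimalMmSRatio`). -/
noncomputable def optimalMmSRatio (d : Utilities N M) : ℝ :=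
  sInf {lam : ℝ | 0 ≤ lam ∧ ∃ S : Allocation N M, SolvesMaxMin lam d S}

theorem maxMinShare_nonpos_of_nonpos (w : M → ℝ) (hw : ∀ j, w j ≤ 0) : maxMinShare N w ≤ 0 := by
  refine Finset.sup'_le _ _ fun S _ => ?_
  exact (Finset.inf'_le _ (mem_univ (0 : Fin N))).trans (Finset.sum_nonpos fun j _ => hw j)

theorem utility_eq_zero_of_maxMinShare_eq_zero (w : M → ℝ) (hw : ∀ j, w j ≤ 0)
    (h : maxMinShare N w = 0) (T : Finset M) : utility w T = 0 := by
  obtain ⟨S, -, hS⟩ := Finset.exists_mem_eq_sup' (univ_nonempty (α := Allocation N M))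
    fun S : Allocation N M => univ.inf' univ_nonempty fun i : Fin N => utility w (S.bundle i)
  have hz : univ.inf' univ_nonempty (fun i : Fin N => utility w (S.bundle i)) = 0 := by
    rw [← hS]; exact h
  have hj : ∀ j, w j = 0 := by
    intro j
    have h1 : (0 : ℝ) ≤ utility w (S.bundle (S j)) := by
      rw [← hz]; exact Finset.inf'_le _ (mem_univ (S j))
    have h2 := (Finset.sum_eq_zero_iff_of_nonpos (fun k _ => hw k)).1
      (le_antisymm (Finset.sum_nonpos fun k _ => hw k) h1)
    exact h2 j (by simp [Allocation.bundle])
  exact Finset.sum_eq_zero fun j _ => hj j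

/-- For chores the minimum in the definition of the optimal ratio exists. -/
theorem isLeast_optimalMmSRatio (d : Utilities N M) (hd : IsNonpositive d) :
    IsLeast {lam : ℝ | 0 ≤ lam ∧ ∃ S : Allocation N M, SolvesMaxMin lam d S}
      (optimalMmSRatio d) := by
  refine IsClosed.csInf_mem ?_ ?_ ⟨0, fun x hx => hx.1⟩ |> fun h =>
    ⟨h, fun x hx => csInf_le ⟨0, fun y hy => hy.1⟩ hx⟩
  rotate_left
  · by_cases h : ∃ i, maxMinShare N (d i) = 0
    · obtain ⟨i, hi⟩ := h
      refine ⟨0, le_rfl, fun _ => i, fun k => ?_⟩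
      rw [zero_mul]
      by_cases hk : k = i
      · rw [hk, utility_eq_zero_of_maxMinShare_eq_zero (d i) (hd i) hi]
      · have : Allocation.bundle (fun _ : M => i) k = ∅ := by
          ext j; simp [Allocation.bundle, Ne.symm hk]
        simp [this, utility]
    · push Not at h
      have hneg : ∀ i, maxMinShare N (d i) < 0 := fun i =>
        lt_of_le_of_ne (maxMinShare_nonpos_of_nonpos (d i) (hd i)) (h i)
      let S : Allocation N M := fun _ => 0
      have hnn : ∀ i, 0 ≤ utility (d i) (S.bundle i) / maxMinShare N (d i) := fun i =>
        div_nonneg_of_nonpos (Finset.sum_nonpos fun j _ => hd i j) (hneg i).le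
      refine ⟨∑ i, utility (d i) (S.bundle i) / maxMinShare N (d i),
        Finset.sum_nonneg fun i _ => hnn i, S, fun i => ?_⟩
      have h1 := Finset.single_le_sum (fun k _ => hnn k) (mem_univ i)
      have h2 := mul_le_mul_of_nonpos_right h1 (hneg i).le
      rwa [div_mul_cancel₀ _ (h i)] at h2
  · have : {lam : ℝ | 0 ≤ lam ∧ ∃ S : Allocation N M, SolvesMaxMin lam d S} =
        Set.Ici 0 ∩ ⋃ S : Allocation N M, ⋂ i : Fin N,
          {lam : ℝ | lam * maxMinShare N (d i) ≤ utility (d i) (S.bundle i)} := by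
      ext lam; simp [SolvesMaxMin]
    rw [this]
    refine isClosed_Ici.inter (isClosed_iUnion_of_finite fun S => isClosed_iInter fun i => ?_)
    exact isClosed_le (by fun_prop) continuous_const

/-! ### The approximation algorithm -/

/-- The optimal makespan of the scheduling problem `R/Cmax` with processing times `p`. -/
noncomputable def optMakespan (p : Utilities N M) : ℝ :=
  univ.inf' univ_nonempty fun S : Allocation N M =>
    univ.sup' univ_nonempty fun i : Fin N => utility (p i) (S.bundle i)

/-- The rescaled utilities: `u i j / c i` if `c i > 0`, and `0` otherwise. -/
noncomputable def rescale (u : Utilities N M) (c : Fin N → ℝ) : Utilities N M :=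
  fun i j => if 0 < c i then 1 / c i * u i j else 0

/-- `(α, β, c, S)` are the quantities chosen and computed in an execution of the approximation
algorithm on the non-negative instance `u` with accuracy `ε`: the numbers `α`, `β` are selected,
then approximate min-max shares `c i` are computed, then an approximately optimal schedule `S` for
the rescaled instance; `S` is the output. -/
structure IsAlgorithmRun (u : Utilities N M) (ε α β : ℝ) (c : Fin N → ℝ) (S : Allocation N M) :
    Prop where
  one_lt_alpha : 1 < α
  one_lt_beta : 1 < β
  mul_lt : α * β < 1 + ε
  share_le : ∀ i, minMaxShare N (u i) ≤ c i
  le_share : ∀ i, c i ≤ α * minMaxShare N (u i)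
  schedule : ∀ i, utility (rescale u c i) (S.bundle i) ≤ β * optMakespan (rescale u c)

end Shares

/-! ### A programming language with bit cost

Data are binary trees with integer leaves.  The cost of a computation charges every elementary step
with the bit sizes of its argument and its result; hence the cost of a computation is at least the
size of its input and of its output, each step can be carried out by a Turing machine in time
polynomial in its cost, and polynomial cost is the same as polynomial time on Turing machines. -/

/-- Binary trees with integer leaves. -/
inductive Data where
  | int (z : ℤ)
  | pair (a b : Data)

namespace Data

/-- The bit size (numbers are written in binary). -/
def size : Data → ℕ
  | int z => 1 + Nat.size z.natAbs
  | pair a b => 1 + a.size + b.size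

def fst : Data → Data
  | int _ => int 0
  | pair a _ => a

def snd : Data → Data
  | int _ => int 0
  | pair _ b => b

def toInt : Data → ℤ
  | int z => z
  | pair _ _ => 0

/-- Lists: `int 0` is the empty list, and `pair a l` is the list with head `a` and tail `l`. -/
def ofList : List Data → Data
  | [] => int 0
  | a :: l => pair a (ofList l)

/-- A rational number in lowest terms, as numerator and denominator. -/
def ofRat (q : ℚ) : Data := pair (int q.num) (int q.den)

/-- The rational number given by a numerator and a denominator (not necessarily coprime). -/
def toRat (a : Data) : ℚ := (a.fst.toInt : ℚ) / (a.snd.toInt : ℚ)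

end Data

/-- Elementary operations. -/
inductive Primitive where
  | id
  | const (z : ℤ)
  | fst
  | snd
  | isPair
  | add
  | sub
  | mul
  | div
  | le

/-- The binary operations act on the two components of a pair of integers; `div` is integer
division; tests return `1` for true and `0` for false. -/
def Primitive.eval : Primitive → Data → Data
  | .id, a => a
  | .const z, _ => .int z
  | .fst, a => a.fst
  | .snd, a => a.snd
  | .isPair, .int _ => .int 0
  | .isPair, .pair _ _ => .int 1
  | .add, a => .int (a.fst.toInt + a.snd.toInt)
  | .sub, a => .int (a.fst.toInt - a.snd.toInt)
  | .mul, a => .int (a.fst.toInt * a.snd.toInt)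
  | .div, a => .int (a.fst.toInt / a.snd.toInt)
  | .le, a => .int (if a.fst.toInt ≤ a.snd.toInt then 1 else 0)

/-- Programs. -/
inductive Program where
  /-- an elementary operation -/
  | prim (o : Primitive)
  /-- first `p`, then `q` on the result of `p` -/
  | seq (p q : Program)
  /-- run `p` and `q` on the same input and form the pair of the results -/
  | pair (p q : Program)
  /-- run the test `c`; then run `p` if the test does not give `0`, and `q` otherwise -/
  | cond (c p q : Program)
  /-- as long as the test `c` does not give `0`, replace the current value by the result of `p` -/
  | loop (c p : Program)

/-- `Runs p a b t`: on input `a` the program `p` halts with result `b` after time `t`. -/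
inductive Program.Runs : Program → Data → Data → ℕ → Prop
  | prim (o : Primitive) (a : Data) :
      Runs (.prim o) a (o.eval a) (1 + a.size + (o.eval a).size)
  | seq {p q : Program} {a b e : Data} {s t : ℕ} :
      Runs p a b s → Runs q b e t → Runs (.seq p q) a e (1 + s + t)
  | pair {p q : Program} {a b e : Data} {s t : ℕ} :
      Runs p a b s → Runs q a e t → Runs (.pair p q) a (.pair b e) (1 + s + t)
  | cond_true {c p q : Program} {a b e : Data} {s t : ℕ} :
      Runs c a b s → b ≠ .int 0 → Runs p a e t → Runs (.cond c p q) a e (1 + s + t)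
  | cond_false {c p q : Program} {a e : Data} {s t : ℕ} :
      Runs c a (.int 0) s → Runs q a e t → Runs (.cond c p q) a e (1 + s + t)
  | loop_done {c p : Program} {a : Data} {s : ℕ} :
      Runs c a (.int 0) s → Runs (.loop c p) a a (1 + s)
  | loop_step {c p : Program} {a b a' e : Data} {s t r : ℕ} :
      Runs c a b s → b ≠ .int 0 → Runs p a a' t → Runs (.loop c p) a' e r →
        Runs (.loop c p) a e (1 + s + t + r)

/-- The running time is at least the size of the input and the size of the result. -/
theorem Program.Runs.size_le {p : Program} {a b : Data} {t : ℕ} (h : p.Runs a b t) :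
    a.size ≤ t ∧ b.size ≤ t := by
  induction h with
  | prim o a => omega
  | seq _ _ _ _ => omega
  | pair _ _ _ _ => simp only [Data.size]; omega
  | cond_true _ _ _ _ _ => omega
  | cond_false _ _ _ _ => omega
  | loop_done _ _ => omega
  | loop_step _ _ _ _ _ _ _ => omega

/-- Programs are deterministic. -/
theorem Program.Runs.deterministic {p : Program} {a b : Data} {t : ℕ} (h : p.Runs a b t) :
    ∀ {b' : Data} {t' : ℕ}, p.Runs a b' t' → b = b' ∧ t = t' := by
  induction h with
  | prim o a => intro b' t' h'; cases h'; exact ⟨rfl, rfl⟩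
  | seq _ _ ih1 ih2 =>
    intro b' t' h'
    cases h' with
    | seq h1 h2 =>
      obtain ⟨rfl, rfl⟩ := ih1 h1
      obtain ⟨rfl, rfl⟩ := ih2 h2
      exact ⟨rfl, rfl⟩
  | pair _ _ ih1 ih2 =>
    intro b' t' h'
    cases h' with
    | pair h1 h2 =>
      obtain ⟨rfl, rfl⟩ := ih1 h1
      obtain ⟨rfl, rfl⟩ := ih2 h2
      exact ⟨rfl, rfl⟩
  | cond_true _ hb _ ih1 ih2 =>
    intro b' t' h'
    cases h' with
    | cond_true h1 _ h2 =>
      obtain ⟨rfl, rfl⟩ := ih1 h1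
      obtain ⟨rfl, rfl⟩ := ih2 h2
      exact ⟨rfl, rfl⟩
    | cond_false h1 _ => exact absurd (ih1 h1).1 hb
  | cond_false _ _ ih1 ih2 =>
    intro b' t' h'
    cases h' with
    | cond_true h1 hb _ => exact absurd (ih1 h1).1.symm hb
    | cond_false h1 h2 =>
      obtain ⟨-, rfl⟩ := ih1 h1
      obtain ⟨rfl, rfl⟩ := ih2 h2
      exact ⟨rfl, rfl⟩
  | loop_done _ ih1 =>
    intro b' t' h'
    cases h' with
    | loop_done h1 =>
      obtain ⟨-, rfl⟩ := ih1 h1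
      exact ⟨rfl, rfl⟩
    | loop_step h1 hb _ _ => exact absurd (ih1 h1).1.symm hb
  | loop_step _ hb _ _ ih1 ih2 ih3 =>
    intro b' t' h'
    cases h' with
    | loop_done h1 => exact absurd (ih1 h1).1 hb
    | loop_step h1 _ h2 h3 =>
      obtain ⟨rfl, rfl⟩ := ih1 h1
      obtain ⟨rfl, rfl⟩ := ih2 h2
      obtain ⟨rfl, rfl⟩ := ih3 h3
      exact ⟨rfl, rfl⟩

/-! ### Polynomial-time approximation schemes -/

/-- An instance with `m` items and rational utilities. -/
abbrev RatUtilities (N m : ℕ) := Fin N → Fin m → ℚ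

/-- A rational instance as a real one. -/
def RatUtilities.toReal {N m : ℕ} (d : RatUtilities N m) : Utilities N (Fin m) :=
  fun i j => (d i j : ℝ)

/-- The encoding of an instance: the list of the items, each given by the list of its values for the
`N` agents. -/
def RatUtilities.encode {N m : ℕ} (d : RatUtilities N m) : Data :=
  .ofList (List.ofFn fun j => .ofList (List.ofFn fun i => .ofRat (d i j)))

/-- The encoding of an allocation: for each item the index of the agent who receives it. -/
def Allocation.encode {N m : ℕ} (S : Allocation N (Fin m)) : Data :=
  .ofList (List.ofFn fun j => .int ((S j : ℕ) : ℤ))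

/-- For every rational `ε > 0` and every non-positive rational instance `d` with `N` agents, the
program, given `d` and `ε`, executes the approximation algorithm for the instance `-d` and `ε`: it
computes an allocation `S`, numbers `α`, `β` and numbers `c i` that form a run of the algorithm. -/
def ExecutesAlgorithm (N : ℕ) [NeZero N] (P : Program) : Prop :=
  ∀ ε : ℚ, 0 < ε → ∀ (m : ℕ) (d : RatUtilities N m), IsNonpositive d.toReal →
    ∃ (S : Allocation N (Fin m)) (a b : Data) (c : Fin N → Data) (t : ℕ),
      P.Runs (.pair d.encode (.ofRat ε))
        (.pair S.encode (.pair a (.pair b (.ofList (List.ofFn c))))) t ∧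
      IsAlgorithmRun (-d.toReal) ε a.toRat b.toRat (fun i => ((c i).toRat : ℝ)) S

/-- `P` is a polynomial-time approximation scheme for the following task on the non-positive
rational instances `d` with `N` agents that satisfy `Promise`: given `d` and a rational `ε > 0`,
compute an allocation `S` with `Good ε d S`.  For every fixed `ε` the running time is bounded by a
polynomial in the size of `d`.  The result of `P` is a pair whose first component is `S`. -/
def IsPTAS (N : ℕ) (P : Program)
    (Promise : ∀ {m : ℕ}, Utilities N (Fin m) → Prop)
    (Good : ∀ {m : ℕ}, ℝ → Utilities N (Fin m) → Allocation N (Fin m) → Prop) : Prop :=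
  ∀ ε : ℚ, 0 < ε → ∃ p : Polynomial ℕ, ∀ (m : ℕ) (d : RatUtilities N m),
    IsNonpositive d.toReal → Promise d.toReal →
      ∃ (S : Allocation N (Fin m)) (e : Data) (t : ℕ),
        P.Runs (.pair d.encode (.ofRat ε)) (.pair S.encode e) t ∧
        t ≤ p.eval d.encode.size ∧ Good ε d.toReal S

/-- `S` is a `(1 + ε)`-approximate optimal max-min share allocation for the chores `d`:
`d_i(S_i) ≥ (1 + ε) * lam * MmS_i` for all `i`, where `lam` is the optimal ratio of `d`. -/
def IsApproxOptimalMmS {N : ℕ} [NeZero N] {M : Type*} [Fintype M] [DecidableEq M]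
    (ε : ℝ) (d : Utilities N M) (S : Allocation N M) : Prop :=
  SolvesMaxMin ((1 + ε) * optimalMmSRatio d) d S

/-- `S` is a `(1 + ε)`-approximate max-min share allocation for the chores `d`. -/
def IsApproxMmS {N : ℕ} [NeZero N] {M : Type*} [Fintype M] [DecidableEq M]
    (ε : ℝ) (d : Utilities N M) (S : Allocation N M) : Prop :=
  SolvesMaxMin (1 + ε) d S

/-! ### Polynomial-time functions between encoded types -/

/-! The guarantee is a chain of two approximations. For `u = -d` the min-max share of agent `i` is
minus its max-min share, so `c i` is that number up to the factor `α`. If an allocation `T` solves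
the `lam`-max-min problem, then each agent's cost in `T` is at most `lam * c i`, so the rescaled
optimal makespan is at most `lam`. The schedule `S` therefore costs agent `i` at most `β * lam * c
i`, which is at most `α * β * lam` times the share. Taking for `lam` the optimal ratio, or `1` if an
MmS allocation exists, gives both estimates (`IsAlgorithmRun.solvesMaxMin`).

For the program, both computations of the algorithm are makespan problems: a min-max share is the
optimal makespan on identical machines, and the rescaled problem has machine-dependent times. After
clearing denominators, one scheme for a fixed number `N` of machines serves for both. Let `U` be the
sum over the `n` jobs of their smallest processing times. Then `OPT ≤ U ≤ N * OPT`. Cut `U` into `K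
= n * N * k` units and round every time down to whole units. A machine loses at most `n` units, that
is `U / (N * k) ≤ OPT / k`. Rounded load vectors, capped at `K + 1`, take at most `(K + 2) ^ N`
values, so a dynamic program keeping one partial schedule per vector finds a schedule within `1 + 1
/ k` of the optimum (`approxSchedule_le`, `length_schedules_le`). With `k > 3 / ε` the two factors
`1 + 1 / k` multiply to less than `1 + ε`.

The running time is obtained compositionally: `PolyTime` is closed under composition, pairing,
branching, arithmetic and those folds whose intermediate values stay polynomially small. Since `K`
enters the time by its value and not by its bit length, `k` is passed in unary; computing it takes a
time that depends on `ε` alone. -/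

/-- Types whose elements are encoded as data. -/
class Enc (α : Type) where
  enc : α → Data

open Enc

instance : Enc Bool := ⟨fun b => .int (if b then 1 else 0)⟩
instance : Enc Unit := ⟨fun _ => .int 0⟩
instance : Enc ℕ := ⟨fun n => .int n⟩
instance : Enc ℤ := ⟨fun z => .int z⟩
instance : Enc ℚ := ⟨Data.ofRat⟩
instance {N : ℕ} : Enc (Fin N) := ⟨fun i => .int ((i : ℕ) : ℤ)⟩
instance {α β : Type} [Enc α] [Enc β] : Enc (α × β) := ⟨fun x => .pair (enc x.1) (enc x.2)⟩
instance {α : Type} [Enc α] : Enc (List α) := ⟨fun l => .ofList (l.map enc)⟩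
instance {N : ℕ} {α : Type} [Enc α] : Enc (Fin N → α) :=
  ⟨fun f => .ofList (List.ofFn fun i => enc (f i))⟩

/-- The size of the encoding. -/
def esize {α : Type} [Enc α] (x : α) : ℕ := (enc x).size

section PolynomialTime

variable {α β γ ι κ : Type} [Enc α] [Enc β] [Enc γ] [Enc ι]

/-! ### Sizes of encodings -/

theorem Data.size_pos (a : Data) : 0 < a.size := by
  cases a <;> simp [Data.size]

theorem esize_pos (x : α) : 0 < esize x := Data.size_pos _

theorem esize_prod (x : α × β) : esize x = 1 + esize x.1 + esize x.2 := rfl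

theorem esize_nat (n : ℕ) : esize n = 1 + Nat.size n := by
  simp [esize, enc, Data.size]

theorem esize_nil : esize ([] : List α) = 1 := by simp [esize, enc, Data.ofList, Data.size]

theorem esize_cons (a : α) (l : List α) : esize (a :: l) = 1 + esize a + esize l := rfl

theorem length_le_esize (l : List α) : l.length ≤ esize l := by
  induction l with
  | nil => simp
  | cons a l ih => rw [esize_cons, List.length_cons]; omega

theorem esize_le_of_mem {a : α} {l : List α} (h : a ∈ l) : esize a ≤ esize l := by
  induction l with
  | nil => simp at h
  | cons b l ih =>
    rw [esize_cons]
    rcases List.mem_cons.1 h with rfl | h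
    · omega
    · have := ih h; omega

theorem esize_le_of_suffix {l l' : List α} (h : l' <:+ l) : esize l' ≤ esize l := by
  obtain ⟨s, rfl⟩ := h
  induction s with
  | nil => rfl
  | cons a s ih => rw [List.cons_append, esize_cons]; omega

theorem esize_list_le (l : List α) (B : ℕ) (h : ∀ a ∈ l, esize a ≤ B) :
    esize l ≤ 1 + l.length * (1 + B) := by
  induction l with
  | nil => simp [esize_nil]
  | cons a l ih =>
    have h1 := ih fun b hb => h b (List.mem_cons_of_mem _ hb)
    have h2 := h a List.mem_cons_self
    rw [esize_cons, List.length_cons, add_mul]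
    omega

theorem esize_reverse (l : List α) : esize l.reverse = esize l := by
  have key : ∀ l l' : List α, esize (l ++ l') + 1 = esize l + esize l' := by
    intro l l'
    induction l with
    | nil => simp only [List.nil_append, esize_nil]; omega
    | cons a l ih => rw [List.cons_append, esize_cons, esize_cons]; omega
  induction l with
  | nil => rfl
  | cons a l ih =>
    have := key l.reverse [a]
    rw [List.reverse_cons, esize_cons]
    rw [esize_cons, esize_nil] at this
    omega

theorem esize_fun_succ {N : ℕ} (f : Fin (N + 1) → α) :
    esize f = 1 + esize (f 0) + esize (fun i : Fin N => f i.succ) := by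
  simp only [esize, enc, List.ofFn_succ, Data.ofList, Data.size]

theorem esize_fun_le {N : ℕ} (f : Fin N → α) (B : ℕ) (h : ∀ i, esize (f i) ≤ B) :
    esize f ≤ 1 + N * (1 + B) := by
  induction N with
  | zero => simp [esize, enc, Data.ofList, Data.size]
  | succ N ih =>
    have h1 := ih (fun i => f i.succ) fun i => h _
    have h2 := h 0
    rw [esize_fun_succ, add_mul]
    omega

theorem esize_fin_le {N : ℕ} (i : Fin N) : esize i ≤ 1 + N := by
  have h : Nat.size (i : ℕ) ≤ N := Nat.size_le.2 (i.2.trans Nat.lt_two_pow_self)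
  simpa [esize, enc, Data.size] using h

theorem esize_nat_mono {a b : ℕ} (h : a ≤ b) : esize a ≤ esize b := by
  rw [esize_nat, esize_nat]
  exact Nat.add_le_add_left (Nat.size_le_size h) 1

/-! #### Polynomial bounds -/

/-- `g` is bounded by a polynomial in the size of the encoding. -/
def PolyBounded (g : α → ℕ) : Prop := ∃ c : ℕ, ∀ x, g x ≤ (esize x + 1) ^ c

namespace PolyBounded

theorem mono {g h : α → ℕ} (hh : PolyBounded h) (hle : ∀ x, g x ≤ h x) : PolyBounded g :=
  hh.imp fun _ hc x => (hle x).trans (hc x)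

theorem const (n : ℕ) : PolyBounded fun _ : α => n :=
  ⟨n, fun x => Nat.lt_two_pow_self.le.trans
    (Nat.pow_le_pow_left (Nat.succ_le_succ (esize_pos x)) n)⟩

theorem esize : PolyBounded fun x : α => esize x := ⟨1, fun x => by simp⟩

theorem add {g h : α → ℕ} (hg : PolyBounded g) (hh : PolyBounded h) :
    PolyBounded fun x => g x + h x := by
  obtain ⟨c, hc⟩ := hg
  obtain ⟨d, hd⟩ := hh
  refine ⟨max c d + 1, fun x => ?_⟩
  have h1 := (hc x).trans (Nat.pow_le_pow_right (by omega) (le_max_left c d))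
  have h2 := (hd x).trans (Nat.pow_le_pow_right (by omega) (le_max_right c d))
  -- The base `esize x + 1` is at least `2`, so one additional factor absorbs the sum of two terms;
  -- this is why bounds of the form `(esize x + 1) ^ c` need no leading coefficient.
  have h3 := Nat.mul_le_mul_left ((_root_.esize x + 1) ^ max c d)
    (Nat.succ_le_succ (esize_pos x))
  rw [pow_succ]
  simp only [Nat.succ_eq_add_one] at h3 ⊢
  omega

theorem mul {g h : α → ℕ} (hg : PolyBounded g) (hh : PolyBounded h) :
    PolyBounded fun x => g x * h x := by
  obtain ⟨c, hc⟩ := hg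
  obtain ⟨d, hd⟩ := hh
  exact ⟨c + d, fun x => by rw [pow_add]; exact Nat.mul_le_mul (hc x) (hd x)⟩

theorem pow {g : α → ℕ} (hg : PolyBounded g) (n : ℕ) : PolyBounded fun x => g x ^ n := by
  obtain ⟨c, hc⟩ := hg
  exact ⟨c * n, fun x => by rw [pow_mul]; exact Nat.pow_le_pow_left (hc x) n⟩

theorem comp {g : β → ℕ} {f : α → β} (hg : PolyBounded g)
    (hf : PolyBounded fun x => _root_.esize (f x)) : PolyBounded fun x => g (f x) := by
  obtain ⟨c, hc⟩ := hg
  exact ((hf.add (const 1)).pow c).mono fun x => hc _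

end PolyBounded

/-- `f` is computed by a program in polynomial time. -/
@[fun_prop]
def PolyTime (f : α → β) : Prop :=
  ∃ (P : Program) (c : ℕ), ∀ x, ∃ t, P.Runs (enc x) (enc (f x)) t ∧ t ≤ (esize x + 1) ^ c

/-! ### Closure properties of polynomial time -/

theorem PolyTime.of_runs {f : α → β} (P : Program) (g : α → ℕ) (hg : PolyBounded g)
    (h : ∀ x, ∃ t, P.Runs (enc x) (enc (f x)) t ∧ t ≤ g x) : PolyTime f := by
  obtain ⟨c, hc⟩ := hg
  refine ⟨P, c, fun x => ?_⟩
  obtain ⟨t, h1, h2⟩ := h x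
  exact ⟨t, h1, h2.trans (hc x)⟩

theorem PolyTime.polyBounded {f : α → β} (hf : PolyTime f) :
    PolyBounded fun x => esize (f x) := by
  obtain ⟨P, c, h⟩ := hf
  refine ⟨c, fun x => ?_⟩
  obtain ⟨t, h1, h2⟩ := h x
  exact h1.size_le.2.trans h2

/-- A program sees only encodings. This allows passing between types with a common encoding, such as
a nonempty tuple and the pair of its head and tail. -/
theorem PolyTime.of_enc_eq {f : α → β} {g : α → γ} (hf : PolyTime f)
    (h : ∀ x, enc (g x) = enc (f x)) : PolyTime g := by
  obtain ⟨P, c, hP⟩ := hf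
  exact ⟨P, c, fun x => by rw [h x]; exact hP x⟩

theorem PolyTime.of_prim {f : α → β} (o : Primitive) (h : ∀ x, o.eval (enc x) = enc (f x))
    (hb : PolyBounded fun x => esize (f x)) : PolyTime f :=
  .of_runs (.prim o) _ (((PolyBounded.const 1).add .esize).add hb) fun x => by
    have hx := Program.Runs.prim o (enc x)
    rw [h x] at hx
    exact ⟨_, hx, le_rfl⟩

@[fun_prop]
theorem PolyTime.id : PolyTime fun x : α => x := .of_prim .id (fun _ => rfl) .esize

theorem PolyTime.comp' {g : β → γ} {f : α → β} (hg : PolyTime g) (hf : PolyTime f) :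
    PolyTime fun x => g (f x) := by
  have hs := hf.polyBounded
  obtain ⟨P, c, hP⟩ := hf
  obtain ⟨Q, d, hQ⟩ := hg
  refine .of_runs (.seq P Q) (fun x => 1 + (esize x + 1) ^ c + (esize (f x) + 1) ^ d)
    (((PolyBounded.const 1).add ((PolyBounded.esize.add (.const 1)).pow c)).add
      ((hs.add (.const 1)).pow d)) fun x => ?_
  obtain ⟨s, h1, h2⟩ := hP x
  obtain ⟨t, h3, h4⟩ := hQ (f x)
  exact ⟨_, .seq h1 h3, by omega⟩

@[fun_prop]
theorem PolyTime.comp {g : β → γ} {f : α → β} (hg : PolyTime g) (hf : PolyTime f) :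
    PolyTime fun x => g (f x) := hg.comp' hf

@[fun_prop]
theorem PolyTime.prodMk {f : α → β} {g : α → γ} (hf : PolyTime f) (hg : PolyTime g) :
    PolyTime fun x => (f x, g x) := by
  obtain ⟨P, c, hP⟩ := hf
  obtain ⟨Q, d, hQ⟩ := hg
  refine .of_runs (.pair P Q) (fun x => 1 + (esize x + 1) ^ c + (esize x + 1) ^ d)
    (((PolyBounded.const 1).add ((PolyBounded.esize.add (.const 1)).pow c)).add
      ((PolyBounded.esize.add (.const 1)).pow d)) fun x => ?_
  obtain ⟨s, h1, h2⟩ := hP x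
  obtain ⟨t, h3, h4⟩ := hQ x
  exact ⟨_, .pair h1 h3, by omega⟩

theorem PolyTime.fst' : PolyTime fun x : α × β => x.1 :=
  .of_prim .fst (fun _ => rfl) (PolyBounded.esize.mono fun x => by rw [esize_prod]; omega)

theorem PolyTime.snd' : PolyTime fun x : α × β => x.2 :=
  .of_prim .snd (fun _ => rfl) (PolyBounded.esize.mono fun x => by rw [esize_prod]; omega)

@[fun_prop]
theorem PolyTime.fst {f : α → β × γ} (hf : PolyTime f) : PolyTime fun x => (f x).1 :=
  PolyTime.fst'.comp' hf

@[fun_prop]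
theorem PolyTime.snd {f : α → β × γ} (hf : PolyTime f) : PolyTime fun x => (f x).2 :=
  PolyTime.snd'.comp' hf

/-- Only integer constants are elementary; larger trees are assembled with `Program.pair`. -/
theorem exists_program_const (a : Data) :
    ∃ P : Program, ∀ b : Data, ∃ t, P.Runs b a t ∧ t ≤ a.size * (b.size + a.size + 1) := by
  induction a with
  | int z =>
    refine ⟨.prim (.const z), fun b => ⟨_, .prim (.const z) b, ?_⟩⟩
    have : 1 ≤ (Data.int z).size := Data.size_pos _
    simp only [Primitive.eval]
    nlinarith
  | pair a b iha ihb =>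
    obtain ⟨P, hP⟩ := iha
    obtain ⟨Q, hQ⟩ := ihb
    refine ⟨.pair P Q, fun e => ?_⟩
    obtain ⟨s, h1, h2⟩ := hP e
    obtain ⟨t, h3, h4⟩ := hQ e
    refine ⟨_, .pair h1 h3, ?_⟩
    simp only [Data.size]
    nlinarith

@[fun_prop]
theorem PolyTime.const (b : β) : PolyTime fun _ : α => b := by
  obtain ⟨P, hP⟩ := exists_program_const (enc b)
  exact .of_runs P (fun x => esize b * (esize x + esize b + 1))
    ((PolyBounded.const _).mul ((PolyBounded.esize.add (.const _)).add (.const _)))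
    fun x => hP (enc x)

@[fun_prop]
theorem PolyTime.cond {b : α → Bool} {f g : α → β} (hb : PolyTime b) (hf : PolyTime f)
    (hg : PolyTime g) : PolyTime fun x => bif b x then f x else g x := by
  obtain ⟨R, e, hR⟩ := hb
  obtain ⟨P, c, hP⟩ := hf
  obtain ⟨Q, d, hQ⟩ := hg
  refine .of_runs (.cond R P Q)
    (fun x => 1 + (esize x + 1) ^ e + (esize x + 1) ^ c + (esize x + 1) ^ d)
    ((((PolyBounded.const 1).add ((PolyBounded.esize.add (.const 1)).pow e)).add
      ((PolyBounded.esize.add (.const 1)).pow c)).add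
        ((PolyBounded.esize.add (.const 1)).pow d)) fun x => ?_
  obtain ⟨r, h5, h6⟩ := hR x
  obtain ⟨s, h1, h2⟩ := hP x
  obtain ⟨t, h3, h4⟩ := hQ x
  cases hx : b x with
  | true =>
    rw [hx] at h5
    exact ⟨_, .cond_true h5 (by simp [enc]) h1, by omega⟩
  | false =>
    rw [hx] at h5
    exact ⟨_, .cond_false h5 h3, by omega⟩

/-! #### Arithmetic -/

theorem Nat.size_add_le (a b : ℕ) : Nat.size (a + b) ≤ Nat.size a + Nat.size b := by
  have h1 := Nat.lt_size_self a
  have h2 := Nat.lt_size_self b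
  rw [Nat.size_le, pow_add]
  nlinarith

theorem Nat.size_mul_le (a b : ℕ) : Nat.size (a * b) ≤ Nat.size a + Nat.size b := by
  rw [Nat.size_le, pow_add]
  exact Nat.mul_lt_mul'' (Nat.lt_size_self a) (Nat.lt_size_self b)

@[fun_prop]
theorem PolyTime.add {f g : α → ℕ} (hf : PolyTime f) (hg : PolyTime g) :
    PolyTime fun x => f x + g x := by
  have h : PolyTime fun p : ℕ × ℕ => p.1 + p.2 :=
    .of_prim .add (fun p => by simp [enc, Primitive.eval, Data.fst, Data.snd, Data.toInt])
      (PolyBounded.esize.mono fun p => by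
        have := Nat.size_add_le p.1 p.2
        simp only [esize_prod, esize_nat]; omega)
  exact h.comp' (hf.prodMk hg)

@[fun_prop]
theorem PolyTime.mul {f g : α → ℕ} (hf : PolyTime f) (hg : PolyTime g) :
    PolyTime fun x => f x * g x := by
  have h : PolyTime fun p : ℕ × ℕ => p.1 * p.2 :=
    .of_prim .mul (fun p => by simp [enc, Primitive.eval, Data.fst, Data.snd, Data.toInt])
      (PolyBounded.esize.mono fun p => by
        have := Nat.size_mul_le p.1 p.2
        simp only [esize_prod, esize_nat]; omega)
  exact h.comp' (hf.prodMk hg)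

@[fun_prop]
theorem PolyTime.div {f g : α → ℕ} (hf : PolyTime f) (hg : PolyTime g) :
    PolyTime fun x => f x / g x := by
  have h : PolyTime fun p : ℕ × ℕ => p.1 / p.2 :=
    .of_prim .div (fun p => by simp [enc, Primitive.eval, Data.fst, Data.snd, Data.toInt])
      (PolyBounded.esize.mono fun p => by
        have := Nat.size_le_size (Nat.div_le_self p.1 p.2)
        simp only [esize_prod, esize_nat]; omega)
  exact h.comp' (hf.prodMk hg)

theorem esize_bool_le (b : Bool) : esize b ≤ 2 := by
  cases b <;> simp [esize, enc, Data.size]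

@[fun_prop]
theorem PolyTime.ble {f g : α → ℕ} (hf : PolyTime f) (hg : PolyTime g) :
    PolyTime fun x => Nat.ble (f x) (g x) := by
  have h : PolyTime fun p : ℕ × ℕ => Nat.ble p.1 p.2 :=
    .of_prim .le (fun p => by simp [enc, Primitive.eval, Data.fst, Data.snd, Data.toInt])
      ((PolyBounded.const 2).mono fun p => esize_bool_le _)
  exact h.comp' (hf.prodMk hg)

@[fun_prop]
theorem PolyTime.and {f g : α → Bool} (hf : PolyTime f) (hg : PolyTime g) :
    PolyTime fun x => f x && g x :=
  (hf.cond hg (.const false)).of_enc_eq fun x => by cases f x <;> rfl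

@[fun_prop]
theorem PolyTime.or {f g : α → Bool} (hf : PolyTime f) (hg : PolyTime g) :
    PolyTime fun x => f x || g x :=
  (hf.cond (.const true) hg).of_enc_eq fun x => by cases f x <;> rfl

@[fun_prop]
theorem PolyTime.natMax {f g : α → ℕ} (hf : PolyTime f) (hg : PolyTime g) :
    PolyTime fun x => max (f x) (g x) :=
  ((hf.ble hg).cond hg hf).of_enc_eq fun x => by
    by_cases h : f x ≤ g x
    · rw [Nat.ble_eq_true_of_le h]; simp [h]
    · rw [max_eq_left (by omega), Bool.eq_false_iff.2 (fun h' => h (Nat.le_of_ble_eq_true h'))]; rfl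

@[fun_prop]
theorem PolyTime.natMin {f g : α → ℕ} (hf : PolyTime f) (hg : PolyTime g) :
    PolyTime fun x => min (f x) (g x) :=
  ((hf.ble hg).cond hf hg).of_enc_eq fun x => by
    by_cases h : f x ≤ g x
    · rw [Nat.ble_eq_true_of_le h]; simp [h]
    · rw [min_eq_right (by omega), Bool.eq_false_iff.2 (fun h' => h (Nat.le_of_ble_eq_true h'))]; rfl

theorem PolyTime.rat_den : PolyTime fun q : ℚ => q.den :=
  .of_prim .snd (fun _ => rfl) (PolyBounded.esize.mono fun q => by
    simp only [esize, enc, Data.ofRat, Data.size]; omega)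

/-- The absolute value is obtained from a sign test and the subtraction `0 - q.num`. -/
theorem PolyTime.rat_num_natAbs : PolyTime fun q : ℚ => q.num.natAbs := by
  have hnum : PolyTime fun q : ℚ => q.num :=
    .of_prim .fst (fun _ => rfl) (PolyBounded.esize.mono fun q => by
      simp only [esize, enc, Data.ofRat, Data.size]; omega)
  have hle : PolyTime fun p : ℕ × ℤ => decide ((p.1 : ℤ) ≤ p.2) :=
    .of_prim .le (fun p => by
      simp only [enc, Primitive.eval, Data.fst, Data.snd, Data.toInt, decide_eq_true_eq]
      congr)
      ((PolyBounded.const 2).mono fun p => esize_bool_le _)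
  have hsub : PolyTime fun p : ℕ × ℤ => (p.1 : ℤ) - p.2 :=
    .of_prim .sub (fun p => by simp [enc, Primitive.eval, Data.fst, Data.snd, Data.toInt])
      (PolyBounded.esize.mono fun p => by
        have h1 : ((p.1 : ℤ) - p.2).natAbs ≤ p.1 + p.2.natAbs := by omega
        have h2 := (Nat.size_le_size h1).trans (Nat.size_add_le _ _)
        simp only [esize, enc, Data.size, Int.natAbs_natCast]; omega)
  have hz : PolyTime fun q : ℚ => ((0 : ℕ), q.num) := (PolyTime.const 0).prodMk hnum
  refine ((hle.comp' hz).cond hnum (hsub.comp' hz)).of_enc_eq fun q => ?_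
  by_cases h : 0 ≤ q.num
  · simp [enc, h]
  · simp only [enc, Nat.cast_zero, h, decide_false, cond_false]
    congr 1; omega

/-! #### Tuples -/

-- The index is part of the program and not of its input. The tail of an encoded tuple is again an
-- encoded tuple, so `i` steps to the tail followed by one projection to the head suffice.
@[fun_prop]
theorem PolyTime.apply {N : ℕ} (i : Fin N) : PolyTime fun f : Fin N → β => f i := by
  induction N with
  | zero => exact i.elim0
  | succ N ih =>
    refine Fin.cases ?_ (fun i => ?_) i
    · exact .of_prim .fst (fun f => by
        simp [enc, List.ofFn_succ, Data.ofList, Primitive.eval, Data.fst])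
        (PolyBounded.esize.mono fun f => by rw [esize_fun_succ]; omega)
    · have h : PolyTime fun (f : Fin (N + 1) → β) (i : Fin N) => f i.succ :=
        .of_prim .snd (fun f => by
          simp [enc, List.ofFn_succ, Data.ofList, Primitive.eval, Data.snd])
          (PolyBounded.esize.mono fun f => by rw [esize_fun_succ]; omega)
      exact (ih i).comp' h

@[fun_prop]
theorem PolyTime.pi {N : ℕ} {f : α → Fin N → β} (hf : ∀ i, PolyTime fun x => f x i) :
    PolyTime f := by
  induction N with
  | zero =>
    exact (PolyTime.const ()).of_enc_eq fun x => by simp [enc, Data.ofList]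
  | succ N ih =>
    have h := (hf 0).prodMk (ih (f := fun x i => f x i.succ) fun i => hf i.succ)
    exact h.of_enc_eq fun x => by simp [enc, List.ofFn_succ, Data.ofList]

/-- The list `L` is fixed, so the fold unrolls into a composition of `L.length` programs. No bound
on the intermediate values is needed, in contrast to folds over an input list. -/
theorem PolyTime.foldr_const (L : List κ) {step : κ → ι → β → β} {init : ι → β}
    (hs : ∀ k, PolyTime fun y : ι × β => step k y.1 y.2) (hi : PolyTime init) :
    PolyTime fun x => L.foldr (fun k b => step k x b) (init x) := by
  induction L with
  | nil => exact hi
  | cons k L ih => exact (hs k).comp' (PolyTime.id.prodMk ih)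

/-! #### Folds -/

@[fun_prop]
theorem PolyTime.cons {f : ι → α} {l : ι → List α} (hf : PolyTime f) (hl : PolyTime l) :
    PolyTime fun x => f x :: l x :=
  (hf.prodMk hl).of_enc_eq fun _ => rfl

/-- The loop state holds the parameter, the accumulator and the remaining list. If all accumulators
have size at most `B`, every state has a size bounded in advance, and each of the at most `l.length
+ 1` rounds costs no more than the bound for such a state. -/
theorem Program.Runs.foldl_loop {step : ι → β → α → β} {T P : Program} {c d : ℕ}
    (hT : ∀ y : (ι × β) × List α,
      ∃ t, T.Runs (enc y) (enc (!y.2.isEmpty)) t ∧ t ≤ (esize y + 1) ^ c)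
    (hP : ∀ y : (ι × β) × (α × List α), ∃ t,
      P.Runs (enc y) (enc ((y.1.1, step y.1.1 y.1.2 y.2.1), y.2.2)) t ∧ t ≤ (esize y + 1) ^ d)
    (x : ι) (B : ℕ) (l : List α) (b : β)
    (h : ∀ l', l' <+: l → esize (l'.foldl (step x) b) ≤ B) :
    ∃ t, (Program.loop T P).Runs (enc ((x, b), l))
        (enc ((x, l.foldl (step x) b), ([] : List α))) t ∧
      t ≤ (l.length + 1) *
        (1 + (3 + esize x + B + esize l) ^ c + (3 + esize x + B + esize l) ^ d) := by
  induction l generalizing b with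
  | nil =>
    obtain ⟨s, h1, h2⟩ := hT ((x, b), [])
    have hb := h [] (List.prefix_rfl)
    refine ⟨_, .loop_done h1, ?_⟩
    have h3 : esize (((x, b), []) : (ι × β) × List α) + 1 ≤ 3 + esize x + B + esize ([] : List α) := by
      simp only [esize_prod]
      simp only [List.foldl_nil] at hb
      omega
    have h4 := h2.trans (Nat.pow_le_pow_left h3 c)
    simp only [List.length_nil, zero_add, one_mul]
    omega
  | cons a l ih =>
    have hb : esize b ≤ B := h [] (List.nil_prefix)
    obtain ⟨s, h1, h2⟩ := hT ((x, b), a :: l)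
    obtain ⟨t, h3, h4⟩ := hP ((x, b), (a, l))
    obtain ⟨r, h5, h6⟩ := ih (step x b a) fun l' hl' => h (a :: l') (by simpa using hl')
    refine ⟨_, .loop_step h1 (by simp [enc]) h3 h5, ?_⟩
    have h7 : esize (((x, b), a :: l) : (ι × β) × List α) + 1 ≤
        3 + esize x + B + esize (a :: l) := by
      simp only [esize_prod]; omega
    have h8 : esize (((x, b), (a, l)) : (ι × β) × (α × List α)) + 1 ≤
        3 + esize x + B + esize (a :: l) := h7
    have h9 := h2.trans (Nat.pow_le_pow_left h7 c)
    have h10 := h4.trans (Nat.pow_le_pow_left h8 d)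
    have h11 : 3 + esize x + B + esize l ≤ 3 + esize x + B + esize (a :: l) := by
      rw [esize_cons]; omega
    have h12 := h6.trans (Nat.mul_le_mul_left (l.length + 1) (Nat.add_le_add
      (Nat.add_le_add_left (Nat.pow_le_pow_left h11 c) 1) (Nat.pow_le_pow_left h11 d)))
    rw [List.length_cons, add_mul (l.length + 1) 1, one_mul]
    omega

/-- Polynomial time of one step is not enough: repeated squaring, for instance, makes the
accumulator explode. Hence the bound `g` on the results over all prefixes, which are the
intermediate accumulators. -/
theorem PolyTime.foldl {l : ι → List α} {init : ι → β} {step : ι → β → α → β}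
    (hs : PolyTime fun y : (ι × α) × β => step y.1.1 y.2 y.1.2)
    (hi : PolyTime init) (hl : PolyTime l) {g : ι → ℕ} (hg : PolyBounded g)
    (h : ∀ x l', l' <+: l x → esize (l'.foldl (step x) (init x)) ≤ g x) :
    PolyTime fun x => (l x).foldl (step x) (init x) := by
  have hT : PolyTime fun y : (ι × β) × List α => !y.2.isEmpty := by
    have h0 : PolyTime fun l : List α => !l.isEmpty :=
      .of_prim .isPair (fun l => by cases l <;> simp [enc, Data.ofList, Primitive.eval])
        ((PolyBounded.const 2).mono fun _ => esize_bool_le _)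
    exact h0.comp' .snd'
  have hP : PolyTime fun y : (ι × β) × (α × List α) =>
      ((y.1.1, step y.1.1 y.1.2 y.2.1), y.2.2) := by
    have := hs.comp' (f := fun y : (ι × β) × (α × List α) => ((y.1.1, y.2.1), y.1.2))
      (by fun_prop)
    exact ((PolyTime.id.fst.fst.prodMk this).prodMk PolyTime.id.snd.snd)
  obtain ⟨T, c, hT⟩ := hT
  obtain ⟨P, d, hP⟩ := hP
  have hstart : PolyTime fun x => ((x, init x), l x) := by fun_prop
  obtain ⟨Q, e, hQ⟩ := hstart
  have main : PolyTime fun x => ((x, (l x).foldl (step x) (init x)), ([] : List α)) := by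
    have hM : PolyBounded fun x => 3 + esize x + g x + esize (l x) :=
      (((PolyBounded.const 3).add .esize).add hg).add hl.polyBounded
    refine .of_runs (.seq Q (.loop T P)) (fun x => 1 + (esize x + 1) ^ e +
      (esize (l x) + 1) * (1 + (3 + esize x + g x + esize (l x)) ^ c +
        (3 + esize x + g x + esize (l x)) ^ d))
      (((PolyBounded.const 1).add ((PolyBounded.esize.add (.const 1)).pow e)).add
        ((hl.polyBounded.add (.const 1)).mul
          (((PolyBounded.const 1).add (hM.pow c)).add (hM.pow d)))) fun x => ?_
    obtain ⟨s, h1, h2⟩ := hQ x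
    obtain ⟨t, h3, h4⟩ := Program.Runs.foldl_loop hT hP x (g x) (l x) (init x) (h x)
    refine ⟨_, .seq h1 h3, ?_⟩
    have h5 := h4.trans (Nat.mul_le_mul_right _ (Nat.succ_le_succ (length_le_esize (l x))))
    exact Nat.add_le_add (by omega) h5
  exact main.fst.snd

theorem PolyTime.reverse {l : ι → List α} (hl : PolyTime l) :
    PolyTime fun x => (l x).reverse := by
  have h1 : ∀ (l' b : List α), l'.foldl (fun b a => a :: b) b = l'.reverse ++ b := by
    intro l'
    induction l' with
    | nil => simp
    | cons a l' ih => simp [ih]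
  have h := PolyTime.foldl (l := fun l : List α => l) (init := fun _ => ([] : List α))
    (step := fun _ b a => a :: b) (g := esize) (by fun_prop) (by fun_prop) .id .esize
    fun x l' hl' => by
      rw [h1, List.append_nil, esize_reverse]
      rw [← esize_reverse l', ← esize_reverse x]
      exact esize_le_of_suffix (List.reverse_suffix.2 hl')
  have h2 : PolyTime fun l : List α => l.reverse :=
    h.of_enc_eq fun l => by
      congr 1
      rw [h1, List.append_nil]
  exact h2.comp' hl

/-- This is a left fold over the reversed list, so its intermediate accumulators belong to the
suffixes of `l x`. -/
theorem PolyTime.foldr {l : ι → List α} {init : ι → β} {step : ι → α → β → β}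
    (hs : PolyTime fun y : (ι × α) × β => step y.1.1 y.1.2 y.2)
    (hi : PolyTime init) (hl : PolyTime l) {g : ι → ℕ} (hg : PolyBounded g)
    (h : ∀ x l', l' <:+ l x → esize (l'.foldr (step x) (init x)) ≤ g x) :
    PolyTime fun x => (l x).foldr (step x) (init x) := by
  have h1 := PolyTime.foldl (step := fun x b a => step x a b) hs hi hl.reverse hg
    fun x l' hl' => by
      have := h x l'.reverse (by
        rw [← List.reverse_prefix, List.reverse_reverse]; exact hl')
      rwa [List.foldr_reverse] at this
  exact h1.of_enc_eq fun x => by rw [List.foldl_reverse]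

/-- Folds in which every step increases the size of the accumulated value by an amount that is
polynomial in the sizes of the parameter and of the list entry. -/
theorem PolyTime.foldr_of_size_le {l : ι → List α} {init : ι → β} {step : ι → α → β → β}
    (hs : PolyTime fun y : (ι × α) × β => step y.1.1 y.1.2 y.2)
    (hi : PolyTime init) (hl : PolyTime l) {g : ι × α → ℕ} (hg : PolyBounded g)
    (h : ∀ x a b, esize (step x a b) ≤ esize b + g (x, a)) :
    PolyTime fun x => (l x).foldr (step x) (init x) := by
  obtain ⟨c, hc⟩ := hg
  refine PolyTime.foldr hs hi hl
    (g := fun x => esize (init x) + esize (l x) * (2 + esize x + esize (l x)) ^ c)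
    (hi.polyBounded.add (hl.polyBounded.mul
      ((((PolyBounded.const 2).add .esize).add hl.polyBounded).pow c))) fun x l' hl' => ?_
  have key : ∀ B, (∀ a ∈ l', g (x, a) ≤ B) →
      esize (l'.foldr (step x) (init x)) ≤ esize (init x) + l'.length * B := by
    intro B hB
    clear hl'
    induction l' with
    | nil => simp
    | cons a l' ih =>
      have h1 := ih fun a ha => hB a (List.mem_cons_of_mem _ ha)
      have h2 := hB a List.mem_cons_self
      have h3 := h x a (l'.foldr (step x) (init x))
      rw [List.foldr_cons, List.length_cons, add_mul, one_mul]
      omega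
  refine (key _ fun a ha => (hc (x, a)).trans (Nat.pow_le_pow_left ?_ c)).trans
    (Nat.add_le_add_left (Nat.mul_le_mul_right _ (hl'.length_le.trans (length_le_esize _))) _)
  have := esize_le_of_mem (hl'.subset ha)
  rw [esize_prod]
  simp only
  omega

theorem PolyTime.map {l : ι → List α} {f : ι → α → β}
    (hf : PolyTime fun y : ι × α => f y.1 y.2) (hl : PolyTime l) :
    PolyTime fun x => (l x).map (f x) := by
  have h := PolyTime.foldr_of_size_le (l := l) (init := fun _ => ([] : List β))
    (step := fun x a b => f x a :: b) (g := fun y => 1 + esize (f y.1 y.2))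
    (by have := hf.comp' (f := fun y : (ι × α) × List β => y.1) (by fun_prop)
        fun_prop)
    (by fun_prop) hl ((PolyBounded.const 1).add hf.polyBounded)
    fun x a b => by rw [esize_cons]; simp only; omega
  exact h.of_enc_eq fun x => by rw [List.foldr_cons_eq_append]; simp

theorem PolyTime.length {l : ι → List α} (hl : PolyTime l) : PolyTime fun x => (l x).length := by
  have h := PolyTime.foldr_of_size_le (l := l) (init := fun _ => 0)
    (step := fun _ _ b => b + 1) (g := fun _ => 1)
    (by fun_prop) (by fun_prop) hl (PolyBounded.const 1) fun x a b => by
      have := Nat.size_add_le b 1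
      rw [Nat.size_one] at this
      rw [esize_nat, esize_nat]; omega
  refine h.of_enc_eq fun x => ?_
  congr 1
  induction l x with
  | nil => rfl
  | cons a l ih => simp [← ih]

theorem PolyTime.foldr_add {l : ι → List α} {f : ι → α → ℕ}
    (hf : PolyTime fun y : ι × α => f y.1 y.2) (hl : PolyTime l) :
    PolyTime fun x => (l x).foldr (fun a b => f x a + b) 0 :=
  PolyTime.foldr_of_size_le (l := l) (init := fun _ => 0)
    (step := fun x a b => f x a + b) (g := fun y => esize (f y.1 y.2))
    (by have := hf.comp' (f := fun y : (ι × α) × ℕ => y.1) (by fun_prop)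
        fun_prop)
    (by fun_prop) hl hf.polyBounded fun x a b => by
      have := Nat.size_add_le (f x a) b
      simp only [esize_nat]; omega

theorem PolyTime.foldr_mul {l : ι → List α} {f : ι → α → ℕ}
    (hf : PolyTime fun y : ι × α => f y.1 y.2) (hl : PolyTime l) :
    PolyTime fun x => (l x).foldr (fun a b => f x a * b) 1 :=
  PolyTime.foldr_of_size_le (l := l) (init := fun _ => 1)
    (step := fun x a b => f x a * b) (g := fun y => esize (f y.1 y.2))
    (by have := hf.comp' (f := fun y : (ι × α) × ℕ => y.1) (by fun_prop)
        fun_prop)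
    (by fun_prop) hl hf.polyBounded fun x a b => by
      have := Nat.size_mul_le (f x a) b
      simp only [esize_nat]; omega

theorem PolyTime.any {l : ι → List α} {f : ι → α → Bool}
    (hf : PolyTime fun y : ι × α => f y.1 y.2) (hl : PolyTime l) :
    PolyTime fun x => (l x).any (f x) := by
  have h := PolyTime.foldr_of_size_le (l := l) (init := fun _ => false)
    (step := fun x a b => f x a || b) (g := fun _ => 2)
    (by have := hf.comp' (f := fun y : (ι × α) × Bool => y.1) (by fun_prop)
        fun_prop)
    (by fun_prop) hl (.const 2) fun x a b => by
      have := esize_bool_le (f x a || b); omega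
  exact h.of_enc_eq fun x => by
    congr 1
    induction l x with
    | nil => rfl
    | cons a l ih => simp [ih]

end PolynomialTime

/-! ### An approximation scheme for makespan scheduling with a fixed number of machines -/

section Algorithm

variable {N : ℕ}

/-- The maximum of the entries. -/
def vecMax (f : Fin N → ℕ) : ℕ := (List.finRange N).foldr (fun i b => max (f i) b) 0

/-- The minimum of the entries. -/
def vecMin [NeZero N] (f : Fin N → ℕ) : ℕ := (List.finRange N).foldr (fun i b => min (f i) b) (f 0)

/-- The product of the entries. -/
def vecProd (f : Fin N → ℕ) : ℕ := (List.finRange N).foldr (fun i b => f i * b) 1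

/-- The equality test for vectors. -/
def vecBeq (f g : Fin N → ℕ) : Bool :=
  (List.finRange N).foldr (fun i b => (Nat.ble (f i) (g i) && Nat.ble (g i) (f i)) && b) true

/-- A partial schedule: capped loads in the rounded instance, loads, and the assignment. -/
abbrev PartialSchedule (N : ℕ) := (Fin N → ℕ) × (Fin N → ℕ) × List (Fin N)

/-- The processing time `a` in the rounded instance: `x.1` is an upper bound for the optimal makespan,
and it is divided into `x.2` units. -/
def roundTime (x : ℕ × ℕ) (a : ℕ) : ℕ := bif Nat.ble a x.1 then a * x.2 / x.1 else x.2 + 1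

/-- Assign a further job with processing times `a` to machine `i`. -/
def extendSchedule (x : ℕ × ℕ) (a : Fin N → ℕ) (s : PartialSchedule N) (i : Fin N) :
    PartialSchedule N :=
  (fun j => min (x.2 + 1) ((if i = j then roundTime x (a j) else 0) + s.1 j),
    fun j => (if i = j then a j else 0) + s.2.1 j, i :: s.2.2)

/-- Add a partial schedule unless one with the same capped rounded loads is present. -/
def insertSchedule (s : PartialSchedule N) (L : List (PartialSchedule N)) :
    List (PartialSchedule N) :=
  bif L.any fun t => vecBeq s.1 t.1 then L else s :: L

/-- Add all extensions of `s` by a job. -/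
def insertExtensions (x : ℕ × ℕ) (a : Fin N → ℕ) (s : PartialSchedule N)
    (L : List (PartialSchedule N)) : List (PartialSchedule N) :=
  (List.finRange N).foldr (fun i b => insertSchedule (extendSchedule x a s i) b) L

/-- The partial schedules that arise from those in `L` by assigning a further job. -/
def scheduleStep (x : ℕ × ℕ) (a : Fin N → ℕ) (L : List (PartialSchedule N)) :
    List (PartialSchedule N) :=
  L.foldr (fun s b => insertExtensions x a s b) []

/-- Partial schedules of the jobs `A` that represent all possible capped rounded loads. -/
def schedules (x : ℕ × ℕ) (A : List (Fin N → ℕ)) : List (PartialSchedule N) :=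
  A.foldr (scheduleStep x) [((fun _ => 0), (fun _ => 0), [])]

/-- An entry of `L` of minimum makespan. -/
def bestSchedule (L : List (PartialSchedule N)) : PartialSchedule N :=
  L.foldr (fun s t => bif Nat.ble (vecMax s.2.1) (vecMax t.2.1) then s else t)
    (L.foldr (fun s _ => s) ((fun _ => 0), (fun _ => 0), []))

/-- The rounding parameters. -/
def roundParams [NeZero N] (A : List (Fin N → ℕ)) (k : ℕ) : ℕ × ℕ :=
  (A.foldr (fun a b => vecMin a + b) 0, A.length * N * k)

/-- A schedule whose makespan is optimal up to the factor `1 + 1 / k`, see `approxSchedule_le`. -/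
def approxSchedule [NeZero N] (A : List (Fin N → ℕ)) (k : ℕ) : PartialSchedule N :=
  bestSchedule (schedules (roundParams A k) A)

end Algorithm

/-! ### Polynomial time of the individual steps of the dynamic program -/

section PolyTime

variable {N : ℕ} {ι : Type} [Enc ι]

@[fun_prop]
theorem polyTime_vecMax {f : ι → Fin N → ℕ} (hf : PolyTime f) :
    PolyTime fun x => vecMax (f x) :=
  (PolyTime.foldr_const (ι := Fin N → ℕ) (List.finRange N) (step := fun i f b => max (f i) b)
    (init := fun _ => 0) (fun i => by fun_prop) (by fun_prop)).comp' hf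

@[fun_prop]
theorem polyTime_vecMin [NeZero N] {f : ι → Fin N → ℕ} (hf : PolyTime f) :
    PolyTime fun x => vecMin (f x) :=
  (PolyTime.foldr_const (ι := Fin N → ℕ) (List.finRange N) (step := fun i f b => min (f i) b)
    (init := fun f => f 0) (fun i => by fun_prop) (by fun_prop)).comp' hf

@[fun_prop]
theorem polyTime_vecProd {f : ι → Fin N → ℕ} (hf : PolyTime f) :
    PolyTime fun x => vecProd (f x) :=
  (PolyTime.foldr_const (ι := Fin N → ℕ) (List.finRange N) (step := fun i f b => f i * b)
    (init := fun _ => 1) (fun i => by fun_prop) (by fun_prop)).comp' hf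

@[fun_prop]
theorem polyTime_vecBeq {f g : ι → Fin N → ℕ} (hf : PolyTime f) (hg : PolyTime g) :
    PolyTime fun x => vecBeq (f x) (g x) :=
  (PolyTime.foldr_const (ι := (Fin N → ℕ) × (Fin N → ℕ)) (List.finRange N)
    (step := fun i f b => (Nat.ble (f.1 i) (f.2 i) && Nat.ble (f.2 i) (f.1 i)) && b)
    (init := fun _ => true) (fun i => by fun_prop) (by fun_prop)).comp' (hf.prodMk hg)

@[fun_prop]
theorem polyTime_roundTime {f : ι → ℕ × ℕ} {g : ι → ℕ} (hf : PolyTime f) (hg : PolyTime g) :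
    PolyTime fun x => roundTime (f x) (g x) := by
  unfold roundTime
  fun_prop

theorem PolyTime.ite_const (p : Prop) [Decidable p] {α : Type} [Enc α] {f g : ι → α}
    (hf : PolyTime f) (hg : PolyTime g) : PolyTime fun x => if p then f x else g x := by
  by_cases h : p
  · simpa [h] using hf
  · simpa [h] using hg

theorem polyTime_extendSchedule (i : Fin N) :
    PolyTime fun y : ((ℕ × ℕ) × (Fin N → ℕ)) × PartialSchedule N =>
      extendSchedule y.1.1 y.1.2 y.2 i := by
  unfold extendSchedule
  refine .prodMk (.pi fun j => .natMin (by fun_prop) (.add (.ite_const _ ?_ ?_) ?_))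
    (.prodMk (.pi fun j => .add (.ite_const _ ?_ ?_) ?_) ?_) <;> fun_prop

theorem polyTime_insertSchedule :
    PolyTime fun y : PartialSchedule N × List (PartialSchedule N) => insertSchedule y.1 y.2 := by
  have h : PolyTime fun y : PartialSchedule N × List (PartialSchedule N) =>
      y.2.any fun t => vecBeq y.1.1 t.1 :=
    PolyTime.any (f := fun (y : PartialSchedule N × List (PartialSchedule N))
      (t : PartialSchedule N) => vecBeq y.1.1 t.1) (by fun_prop) (by fun_prop)
  unfold insertSchedule
  fun_prop

theorem esize_insertSchedule_le (s : PartialSchedule N) (L : List (PartialSchedule N)) :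
    esize (insertSchedule s L) ≤ esize L + (1 + esize s) := by
  unfold insertSchedule
  cases L.any fun t => vecBeq s.1 t.1
  · rw [cond_false, esize_cons]; omega
  · rw [cond_true]; omega

theorem polyTime_insertExtensions :
    PolyTime fun y : (((ℕ × ℕ) × (Fin N → ℕ)) × PartialSchedule N) × List (PartialSchedule N) =>
      insertExtensions y.1.1.1 y.1.1.2 y.1.2 y.2 := by
  refine PolyTime.foldr_const (List.finRange N)
    (step := fun i (y : (((ℕ × ℕ) × (Fin N → ℕ)) × PartialSchedule N) × List (PartialSchedule N))
      (b : List (PartialSchedule N)) => insertSchedule (extendSchedule y.1.1.1 y.1.1.2 y.1.2 i) b)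
    (init := fun y => y.2) (fun i => ?_) (by fun_prop)
  have h := (polyTime_extendSchedule (N := N) i).comp' (f := fun y : ((((ℕ × ℕ) × (Fin N → ℕ)) ×
    PartialSchedule N) × List (PartialSchedule N)) × List (PartialSchedule N) => y.1.1)
    (by fun_prop)
  exact polyTime_insertSchedule.comp' (h.prodMk .snd')

theorem esize_insertExtensions_le (x : ℕ × ℕ) (a : Fin N → ℕ) (s : PartialSchedule N)
    (L : List (PartialSchedule N)) : esize (insertExtensions x a s L) ≤
      esize L + ((List.finRange N).map fun i => 1 + esize (extendSchedule x a s i)).sum := by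
  unfold insertExtensions
  induction List.finRange N with
  | nil => simp
  | cons i l ih =>
    have := esize_insertSchedule_le (extendSchedule x a s i)
      (l.foldr (fun i b => insertSchedule (extendSchedule x a s i) b) L)
    simp only [List.foldr_cons, List.map_cons, List.sum_cons] at ih ⊢
    omega

/-- Every old entry adds at most its `N` extensions, whose sizes do not depend on the list built so
far; so the growth is additive. -/
theorem polyTime_scheduleStep :
    PolyTime fun y : ((ℕ × ℕ) × (Fin N → ℕ)) × List (PartialSchedule N) =>
      scheduleStep y.1.1 y.1.2 y.2 := by
  refine PolyTime.foldr_of_size_le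
    (step := fun (y : ((ℕ × ℕ) × (Fin N → ℕ)) × List (PartialSchedule N)) s b =>
      insertExtensions y.1.1 y.1.2 s b)
    (g := fun z => ((List.finRange N).map fun i =>
      1 + esize (extendSchedule z.1.1.1 z.1.1.2 z.2 i)).sum) ?_ (by fun_prop) (by fun_prop) ?_
    fun y s b => esize_insertExtensions_le y.1.1 y.1.2 s b
  · exact polyTime_insertExtensions.comp' (f := fun y : ((((ℕ × ℕ) × (Fin N → ℕ)) ×
      List (PartialSchedule N)) × PartialSchedule N) × List (PartialSchedule N) =>
      ((y.1.1.1, y.1.2), y.2)) (by fun_prop)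
  · induction List.finRange N with
    | nil => exact .const 0
    | cons i l ih =>
      simp only [List.map_cons, List.sum_cons]
      refine ((PolyBounded.const 1).add (PolyTime.polyBounded ?_)).add ih
      exact (polyTime_extendSchedule i).comp' (f := fun z : (((ℕ × ℕ) × (Fin N → ℕ)) ×
          List (PartialSchedule N)) × PartialSchedule N => (z.1.1, z.2)) (by fun_prop)

theorem polyTime_bestSchedule :
    PolyTime fun L : List (PartialSchedule N) => bestSchedule L := by
  have h0 : PolyTime fun L : List (PartialSchedule N) =>
      L.foldr (fun s _ => s) ((fun _ => 0), (fun _ => 0), []) :=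
    PolyTime.foldr_of_size_le (step := fun _ s _ => s) (g := fun z => esize z)
      (by fun_prop) (by fun_prop) .id .esize fun x a b =>
      (Nat.le_add_left _ _).trans (Nat.le_add_left _ _)
  refine PolyTime.foldr_of_size_le (g := fun z => esize z) (step := fun _ s t =>
    bif Nat.ble (vecMax s.2.1) (vecMax t.2.1) then s else t) (by fun_prop) h0 .id .esize ?_
  intro x s t
  cases Nat.ble (vecMax s.2.1) (vecMax t.2.1)
  · rw [cond_false]; omega
  · exact (Nat.le_add_left _ _).trans (Nat.le_add_left _ _)

theorem polyTime_roundParams [NeZero N] :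
    PolyTime fun y : List (Fin N → ℕ) × ℕ => roundParams y.1 y.2 := by
  have h1 : PolyTime fun y : List (Fin N → ℕ) × ℕ => y.1.foldr (fun a b => vecMin a + b) 0 :=
    PolyTime.foldr_add (f := fun _ a => vecMin a) (by fun_prop) (by fun_prop)
  have h2 : PolyTime fun y : List (Fin N → ℕ) × ℕ => y.1.length :=
    PolyTime.length (by fun_prop)
  unfold roundParams
  fun_prop

end PolyTime

/-! #### Correctness of the dynamic program -/

section Semantics

variable {N : ℕ}

theorem vecMax_le_iff {f : Fin N → ℕ} {b : ℕ} : vecMax f ≤ b ↔ ∀ i, f i ≤ b := by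
  have h : ∀ L : List (Fin N), L.foldr (fun i b => max (f i) b) 0 ≤ b ↔ ∀ i ∈ L, f i ≤ b := by
    intro L
    induction L with
    | nil => simp
    | cons i L ih => simp [ih]
  simp [vecMax, h]

theorem le_vecMax (f : Fin N → ℕ) (i : Fin N) : f i ≤ vecMax f := vecMax_le_iff.1 le_rfl i

theorem vecMin_le [NeZero N] (f : Fin N → ℕ) (i : Fin N) : vecMin f ≤ f i := by
  have h : ∀ L : List (Fin N), i ∈ L → L.foldr (fun i b => min (f i) b) (f 0) ≤ f i := by
    intro L
    induction L with
    | nil => simp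
    | cons j L ih =>
      intro hi
      rcases List.mem_cons.1 hi with rfl | hi
      · exact min_le_left _ _
      · exact (min_le_right _ _).trans (ih hi)
  exact h _ (List.mem_finRange i)

theorem exists_vecMin_eq [NeZero N] (f : Fin N → ℕ) : ∃ i, vecMin f = f i := by
  unfold vecMin
  induction List.finRange N with
  | nil => exact ⟨0, rfl⟩
  | cons j L ih =>
    obtain ⟨i, hi⟩ := ih
    rw [List.foldr_cons, hi]
    rcases min_choice (f j) (f i) with h | h
    · exact ⟨j, h⟩
    · exact ⟨i, h⟩

theorem dvd_vecProd (f : Fin N → ℕ) (i : Fin N) : f i ∣ vecProd f := by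
  have h : ∀ L : List (Fin N), i ∈ L → f i ∣ L.foldr (fun i b => f i * b) 1 := by
    intro L
    induction L with
    | nil => simp
    | cons j L ih =>
      intro hi
      rcases List.mem_cons.1 hi with rfl | hi
      · exact dvd_mul_right _ _
      · exact (ih hi).mul_left _
  exact h _ (List.mem_finRange i)

theorem vecProd_pos {f : Fin N → ℕ} (hf : ∀ i, 0 < f i) : 0 < vecProd f := by
  unfold vecProd
  induction List.finRange N with
  | nil => simp
  | cons j L ih => exact Nat.mul_pos (hf j) ih

theorem vecBeq_iff {f g : Fin N → ℕ} : vecBeq f g = true ↔ f = g := by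
  have h : ∀ L : List (Fin N), L.foldr
      (fun i b => (Nat.ble (f i) (g i) && Nat.ble (g i) (f i)) && b) true = true ↔
      ∀ i ∈ L, f i = g i := by
    intro L
    induction L with
    | nil => simp
    | cons j L ih => simp only [List.foldr_cons, Bool.and_eq_true, Nat.ble_eq, ih,
      List.forall_mem_cons, Nat.le_antisymm_iff]
  simp [vecBeq, h, funext_iff]

/-- The load of machine `j` when the jobs with processing times `A` are assigned by `T`. -/
def listLoad : List (Fin N → ℕ) → List (Fin N) → Fin N → ℕ
  | a :: A, i :: T, j => (if i = j then a j else 0) + listLoad A T j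
  | _, _, _ => 0

/-- The processing times of a job in the rounded instance. -/
def roundVec (x : ℕ × ℕ) (a : Fin N → ℕ) (j : Fin N) : ℕ := roundTime x (a j)

/-- `s` describes a schedule of the jobs `A`. -/
structure IsSchedule (x : ℕ × ℕ) (A : List (Fin N → ℕ)) (s : PartialSchedule N) : Prop where
  length_eq : s.2.2.length = A.length
  load_eq : ∀ j, s.2.1 j = listLoad A s.2.2 j
  key_eq : ∀ j, s.1 j = min (x.2 + 1) (listLoad (A.map (roundVec x)) s.2.2 j)

theorem IsSchedule.extend {x : ℕ × ℕ} {A : List (Fin N → ℕ)} {s : PartialSchedule N}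
    (hs : IsSchedule x A s) (a : Fin N → ℕ) (i : Fin N) :
    IsSchedule x (a :: A) (extendSchedule x a s i) := by
  refine ⟨by simp [extendSchedule, hs.length_eq], fun j => ?_, fun j => ?_⟩
  · simp only [extendSchedule, listLoad, hs.load_eq]
  · simp only [extendSchedule, listLoad, List.map_cons, hs.key_eq, roundVec]
    -- Capping after each addition gives the same result as capping the full sum once.
    omega

theorem insertSchedule_cases (s : PartialSchedule N) (L : List (PartialSchedule N)) :
    (insertSchedule s L = L ∧ ∃ t ∈ L, t.1 = s.1) ∨
      (insertSchedule s L = s :: L ∧ s.1 ∉ L.map Prod.fst) := by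
  unfold insertSchedule
  cases h : L.any fun t => vecBeq s.1 t.1 with
  | true =>
    obtain ⟨t, ht, h⟩ := List.any_eq_true.1 h
    exact .inl ⟨rfl, t, ht, (vecBeq_iff.1 h).symm⟩
  | false =>
    refine .inr ⟨rfl, fun hs => ?_⟩
    obtain ⟨t, ht, h1⟩ := List.mem_map.1 hs
    exact List.any_eq_false.1 h t ht (vecBeq_iff.2 h1.symm)

theorem foldr_insertSchedule_subset (M : List (PartialSchedule N)) :
    M.foldr insertSchedule [] ⊆ M := by
  induction M with
  | nil => simp
  | cons s M ih =>
    rw [List.foldr_cons]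
    rcases insertSchedule_cases s (M.foldr insertSchedule []) with h | h
    · rw [h.1]; exact List.subset_cons_of_subset _ ih
    · rw [h.1]; exact List.cons_subset_cons _ ih

theorem exists_mem_foldr_insertSchedule {M : List (PartialSchedule N)} {s : PartialSchedule N}
    (hs : s ∈ M) : ∃ t ∈ M.foldr insertSchedule [], t.1 = s.1 := by
  induction M with
  | nil => simp at hs
  | cons r M ih =>
    rw [List.foldr_cons]
    rcases insertSchedule_cases r (M.foldr insertSchedule []) with h | h <;> rw [h.1] <;>
      rcases List.mem_cons.1 hs with rfl | hs
    · exact h.2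
    · exact ih hs
    · exact ⟨_, List.mem_cons_self, rfl⟩
    · obtain ⟨t, ht, h1⟩ := ih hs
      exact ⟨t, List.mem_cons_of_mem _ ht, h1⟩

theorem nodup_foldr_insertSchedule (M : List (PartialSchedule N)) :
    ((M.foldr insertSchedule []).map Prod.fst).Nodup := by
  induction M with
  | nil => simp
  | cons s M ih =>
    rw [List.foldr_cons]
    rcases insertSchedule_cases s (M.foldr insertSchedule []) with h | h
    · rwa [h.1]
    · rw [h.1, List.map_cons]; exact List.nodup_cons.2 ⟨h.2, ih⟩

/-- The nested folds amount to removing duplicate keys from the list of all extensions, which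
reduces the analysis to `foldr insertSchedule []`. -/
theorem scheduleStep_eq (x : ℕ × ℕ) (a : Fin N → ℕ) (L : List (PartialSchedule N)) :
    scheduleStep x a L =
      (L.flatMap fun s => (List.finRange N).map (extendSchedule x a s)).foldr
        insertSchedule [] := by
  unfold scheduleStep
  induction L with
  | nil => rfl
  | cons s L ih =>
    rw [List.foldr_cons, ih, List.flatMap_cons, List.foldr_append, List.foldr_map]
    rfl

theorem isSchedule_of_mem_schedules {x : ℕ × ℕ} {A : List (Fin N → ℕ)} :
    ∀ s ∈ schedules x A, IsSchedule x A s := by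
  induction A with
  | nil =>
    intro s hs
    obtain rfl := List.mem_singleton.1 hs
    exact ⟨rfl, fun j => by simp [listLoad], fun j => by simp [listLoad]⟩
  | cons a A ih =>
    intro s hs
    have h : schedules x (a :: A) = scheduleStep x a (schedules x A) := rfl
    rw [h, scheduleStep_eq] at hs
    obtain ⟨t, ht, h1⟩ := List.mem_flatMap.1 (foldr_insertSchedule_subset _ hs)
    obtain ⟨i, -, rfl⟩ := List.mem_map.1 h1
    exact (ih t ht).extend a i

/-- The key of an extension depends only on the old key, the job and the machine. So a discarded
schedule may be replaced by the kept one with the same key, and every later choice remains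
available. -/
theorem exists_mem_schedules {x : ℕ × ℕ} {A : List (Fin N → ℕ)} {T : List (Fin N)}
    (hT : T.length = A.length) :
    ∃ s ∈ schedules x A, ∀ j, s.1 j = min (x.2 + 1) (listLoad (A.map (roundVec x)) T j) := by
  induction A generalizing T with
  | nil => exact ⟨_, List.mem_singleton.2 rfl, fun j => by simp [listLoad]⟩
  | cons a A ih =>
    cases T with
    | nil => simp at hT
    | cons i T =>
      obtain ⟨s, hs, h1⟩ := ih (T := T) (by simpa using hT)
      have h : schedules x (a :: A) = scheduleStep x a (schedules x A) := rfl
      rw [h, scheduleStep_eq]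
      obtain ⟨t, ht, h2⟩ := exists_mem_foldr_insertSchedule
        (List.mem_flatMap (f := fun s => (List.finRange N).map (extendSchedule x a s)).2
          ⟨s, hs, List.mem_map.2 ⟨i, List.mem_finRange i, rfl⟩⟩)
      refine ⟨t, ht, fun j => ?_⟩
      rw [h2]
      simp only [extendSchedule, listLoad, List.map_cons, h1, roundVec]
      omega

theorem nodup_schedules (x : ℕ × ℕ) (A : List (Fin N → ℕ)) :
    ((schedules x A).map Prod.fst).Nodup := by
  cases A with
  | nil => simp [schedules]
  | cons a A =>
    have h : schedules x (a :: A) = scheduleStep x a (schedules x A) := rfl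
    rw [h, scheduleStep_eq]
    exact nodup_foldr_insertSchedule _

/-- Keys are pairwise distinct, and each of their `N` coordinates lies in `{0, ..., x.2 + 1}`. -/
theorem length_schedules_le (x : ℕ × ℕ) (A : List (Fin N → ℕ)) :
    (schedules x A).length ≤ (x.2 + 2) ^ N := by
  have h1 : ((schedules x A).map Prod.fst).toFinset ⊆
      Fintype.piFinset fun _ : Fin N => Finset.range (x.2 + 2) := by
    intro f hf
    obtain ⟨s, hs, rfl⟩ := List.mem_map.1 (List.mem_toFinset.1 hf)
    refine Fintype.mem_piFinset.2 fun j => ?_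
    rw [(isSchedule_of_mem_schedules s hs).key_eq j, Finset.mem_range]
    omega
  have h2 := Finset.card_le_card h1
  rw [List.toFinset_card_of_nodup (nodup_schedules x A), Fintype.card_piFinset] at h2
  simpa using h2

theorem bestSchedule_mem_and_le {L : List (PartialSchedule N)} (hL : L ≠ []) :
    bestSchedule L ∈ L ∧ ∀ s ∈ L, vecMax (bestSchedule L).2.1 ≤ vecMax s.2.1 := by
  unfold bestSchedule
  set d : PartialSchedule N := L.foldr (fun s _ => s) ((fun _ => 0), (fun _ => 0), []) with hd
  have hdL : d ∈ L := by
    cases L with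
    | nil => exact absurd rfl hL
    | cons s L => rw [hd]; exact List.mem_cons_self
  have key : ∀ M : List (PartialSchedule N),
      let r := M.foldr
        (fun s t => bif Nat.ble (vecMax s.2.1) (vecMax t.2.1) then s else t) d
      (r = d ∨ r ∈ M) ∧ ∀ s ∈ M, vecMax r.2.1 ≤ vecMax s.2.1 := by
    intro M
    induction M with
    | nil => simp
    | cons s M ih =>
      simp only [List.foldr_cons] at ih ⊢
      generalize M.foldr
        (fun s t => bif Nat.ble (vecMax s.2.1) (vecMax t.2.1) then s else t) d = r at ih ⊢
      by_cases h : vecMax s.2.1 ≤ vecMax r.2.1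
      · rw [Nat.ble_eq_true_of_le h, cond_true]
        refine ⟨.inr List.mem_cons_self, fun t ht => ?_⟩
        rcases List.mem_cons.1 ht with rfl | ht
        · exact le_rfl
        · exact h.trans (ih.2 t ht)
      · rw [Bool.eq_false_iff.2 fun h' => h (Nat.le_of_ble_eq_true h'), cond_false]
        refine ⟨ih.1.imp_right fun h => List.mem_cons_of_mem _ h, fun t ht => ?_⟩
        rcases List.mem_cons.1 ht with rfl | ht
        · omega
        · exact ih.2 t ht
  obtain ⟨h1, h2⟩ := key L
  refine ⟨?_, h2⟩
  rcases h1 with h1 | h1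
  · rw [h1]; exact hdL
  · exact h1

/-! #### Quality of the approximation -/

/-- Rounding down never increases a load, measured in units `x.1 / x.2`; the load bound ensures that
no job used here is longer than `x.1`. The second claim covers `x.1 = 0`, where the inequality is
void. -/
theorem listLoad_roundVec_mul_le {x : ℕ × ℕ} {j : Fin N} :
    ∀ (A : List (Fin N → ℕ)) (T : List (Fin N)), listLoad A T j ≤ x.1 →
      listLoad (A.map (roundVec x)) T j * x.1 ≤ x.2 * listLoad A T j ∧
        (x.1 = 0 → listLoad (A.map (roundVec x)) T j = 0)
  | [], _, _ => by simp [listLoad]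
  | _ :: _, [], _ => by simp [listLoad]
  | a :: A, i :: T, h => by
    simp only [listLoad, List.map_cons] at h ⊢
    obtain ⟨h1, h2⟩ := listLoad_roundVec_mul_le A T (x := x) (j := j) (by omega)
    by_cases hij : i = j
    · simp only [hij, if_true] at h ⊢
      have h3 : roundVec x a j = a j * x.2 / x.1 := by
        rw [roundVec, roundTime, Nat.ble_eq_true_of_le (by omega), cond_true]
      have h4 := Nat.div_mul_le_self (a j * x.2) x.1
      rw [h3]
      refine ⟨by nlinarith, fun h0 => ?_⟩
      rw [h2 h0, h0, Nat.div_zero]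
    · simpa [hij] using ⟨h1, h2⟩

/-- Each job loses at most one unit by rounding. A job longer than `x.1` cannot occur on machine
`j`, as it would contribute `x.2 + 1` units. -/
theorem listLoad_mul_le {x : ℕ × ℕ} {j : Fin N} :
    ∀ (A : List (Fin N → ℕ)) (T : List (Fin N)), listLoad (A.map (roundVec x)) T j ≤ x.2 →
      listLoad A T j * x.2 ≤ (listLoad (A.map (roundVec x)) T j + A.length) * x.1
  | [], _, _ => by simp [listLoad]
  | _ :: _, [], _ => by simp [listLoad]
  | a :: A, i :: T, h => by
    simp only [listLoad, List.map_cons, List.length_cons] at h ⊢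
    have h1 := listLoad_mul_le A T (x := x) (j := j) (by omega)
    by_cases hij : i = j
    · simp only [hij, if_true] at h ⊢
      have hle : a j ≤ x.1 := by
        by_contra hlt
        rw [roundVec, roundTime, Bool.eq_false_iff.2 fun h' => hlt (Nat.le_of_ble_eq_true h'),
          cond_false] at h
        omega
      have h3 : roundVec x a j = a j * x.2 / x.1 := by
        rw [roundVec, roundTime, Nat.ble_eq_true_of_le hle, cond_true]
      have h4 : a j * x.2 ≤ (a j * x.2 / x.1 + 1) * x.1 := by
        rcases Nat.eq_zero_or_pos x.1 with h0 | h0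
        · have : a j = 0 := by omega
          simp [this]
        · rw [mul_comm (_ + 1)]; exact (Nat.lt_mul_div_succ _ h0).le
      rw [h3]
      nlinarith
    · simp only [hij, if_false, zero_add]
      nlinarith

/-- Wherever a job is placed, it takes at least its smallest processing time. -/
theorem sum_vecMin_le [NeZero N] :
    ∀ (A : List (Fin N → ℕ)) (T : List (Fin N)), T.length = A.length →
      A.foldr (fun a b => vecMin a + b) 0 ≤ ∑ j, listLoad A T j
  | [], _, _ => by simp
  | _ :: _, [], h => by simp at h
  | a :: A, i :: T, h => by
    have h1 := sum_vecMin_le A T (by simpa using h)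
    have h2 := vecMin_le a i
    simp only [List.foldr_cons, listLoad, Finset.sum_add_distrib, Finset.sum_ite_eq,
      Finset.mem_univ, if_true]
    omega

/-- Place every job on a machine where it is fastest; even the total load then equals the bound. -/
theorem exists_listLoad_le [NeZero N] (A : List (Fin N → ℕ)) :
    ∃ T : List (Fin N), T.length = A.length ∧
      ∀ j, listLoad A T j ≤ A.foldr (fun a b => vecMin a + b) 0 := by
  induction A with
  | nil => exact ⟨[], rfl, fun j => by simp [listLoad]⟩
  | cons a A ih =>
    obtain ⟨T, hT, h⟩ := ih
    obtain ⟨i, hi⟩ := exists_vecMin_eq a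
    refine ⟨i :: T, by simp [hT], fun j => ?_⟩
    have := h j
    simp only [listLoad, List.foldr_cons, hi]
    by_cases hij : i = j
    · simp only [hij, if_true]; omega
    · simp only [hij, if_false]; omega

theorem isSchedule_approxSchedule [NeZero N] (A : List (Fin N → ℕ)) (k : ℕ) :
    IsSchedule (roundParams A k) A (approxSchedule A k) := by
  have hne : schedules (roundParams A k) A ≠ [] := by
    obtain ⟨T, hT, -⟩ := exists_listLoad_le A
    obtain ⟨s, hs, -⟩ := exists_mem_schedules (x := roundParams A k) hT
    exact List.ne_nil_of_mem hs
  exact isSchedule_of_mem_schedules _ (bestSchedule_mem_and_le hne).1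

/-- Compare with the kept schedule `s` that has the same key as `T`: its true loads exceed the
rounded loads of `T` by at most `A.length` units, and this is at most a `1 / k` fraction of the
makespan of `T` because `U ≤ N * t`. -/
theorem approxSchedule_le [NeZero N] (A : List (Fin N → ℕ)) (k : ℕ) (T : List (Fin N))
    (hT : T.length = A.length) :
    vecMax (approxSchedule A k).2.1 * k ≤ (k + 1) * vecMax (listLoad A T) := by
  set U := A.foldr (fun a b => vecMin a + b) 0 with hU
  -- it suffices to consider schedules whose makespan is at most `U`
  wlog hle : vecMax (listLoad A T) ≤ U generalizing T with H
  · obtain ⟨T', hT', h'⟩ := exists_listLoad_le A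
    have h1 : vecMax (listLoad A T') ≤ U := vecMax_le_iff.2 h'
    exact (H T' hT' h1).trans (Nat.mul_le_mul_left _ (by omega))
  set x := roundParams A k with hx
  have hx1 : x.1 = U := rfl
  have hx2 : x.2 = A.length * N * k := rfl
  obtain ⟨s, hs, hkey⟩ := exists_mem_schedules (x := x) hT
  refine (Nat.mul_le_mul_right k
    ((bestSchedule_mem_and_le (List.ne_nil_of_mem hs)).2 s hs)).trans ?_
  have hsch := isSchedule_of_mem_schedules s hs
  set t := vecMax (listLoad A T) with ht
  have hUN : U ≤ N * t := by
    refine (sum_vecMin_le A T hT).trans ?_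
    simpa using Finset.sum_le_card_nsmul Finset.univ (listLoad A T) t fun j _ => le_vecMax _ j
  have hs_load : ∀ j, s.2.1 j * k ≤ (k + 1) * t := by
    intro j
    have htj : listLoad A T j ≤ t := le_vecMax _ j
    obtain ⟨h1, h2⟩ := listLoad_roundVec_mul_le (x := x) (j := j) A T (by omega)
    have h3 : listLoad (A.map (roundVec x)) T j ≤ x.2 := by
      rcases Nat.eq_zero_or_pos x.1 with h0 | h0
      · rw [h2 h0]; omega
      · refine Nat.le_of_mul_le_mul_right (h1.trans (Nat.mul_le_mul_left _ ?_)) h0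
        omega
    -- The rounded load of `T` lies strictly below the cap `x.2 + 1`, so equality of the capped
    -- loads is equality of the loads.
    have h4 : listLoad (A.map (roundVec x)) s.2.2 j = listLoad (A.map (roundVec x)) T j := by
      have h5 := hkey j
      rw [hsch.key_eq j] at h5
      omega
    have h5 := listLoad_mul_le (x := x) (j := j) A s.2.2 (by omega)
    rw [h4, ← hsch.load_eq] at h5
    rcases Nat.eq_zero_or_pos A.length with h0 | h0
    · have h6 : A = [] := List.length_eq_zero_iff.1 h0
      rw [hsch.load_eq, h6]
      simp [listLoad]
    · have h6 : s.2.1 j * k * (A.length * N) ≤ (k + 1) * t * (A.length * N) :=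
        calc s.2.1 j * k * (A.length * N) = s.2.1 j * x.2 := by rw [hx2]; ring
          _ ≤ listLoad (A.map (roundVec x)) T j * x.1 + A.length * x.1 := by
            rw [← add_mul]; exact h5
          _ ≤ x.2 * t + A.length * (N * t) := Nat.add_le_add
            (h1.trans (Nat.mul_le_mul_left _ htj)) (Nat.mul_le_mul_left _ hUN)
          _ = (k + 1) * t * (A.length * N) := by rw [hx2]; ring
      exact Nat.le_of_mul_le_mul_right h6 (Nat.mul_pos h0 (Nat.pos_of_ne_zero (NeZero.ne N)))
  rcases Nat.eq_zero_or_pos k with rfl | hk0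
  · simp
  · rw [← Nat.le_div_iff_mul_le hk0]
    exact vecMax_le_iff.2 fun j => (Nat.le_div_iff_mul_le hk0).2 (hs_load j)

/-! #### Running time -/

theorem listLoad_le_sum (j : Fin N) : ∀ (A : List (Fin N → ℕ)) (T : List (Fin N)),
    listLoad A T j ≤ A.foldr (fun a b => vecMax a + b) 0
  | [], _ => by simp [listLoad]
  | _ :: _, [] => by simp [listLoad]
  | a :: A, i :: T => by
    have h1 := listLoad_le_sum j A T
    have h2 := le_vecMax a j
    simp only [listLoad, List.foldr_cons]
    split_ifs <;> omega

/-- The number of entries is controlled by the value of `(f y).2`, hence `hf2`. An entry is small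
because its keys are capped, its loads are at most the sum of the maximal times, and its assignment
has one index per job. -/
theorem PolyTime.schedules {ι : Type} [Enc ι] {f : ι → ℕ × ℕ} {A : ι → List (Fin N → ℕ)}
    (hf : PolyTime f) (hA : PolyTime A) (hf2 : PolyBounded fun y => (f y).2) :
    PolyTime fun y => schedules (f y) (A y) := by
  have hW : PolyTime fun y => (A y).foldr (fun a b => vecMax a + b) 0 :=
    PolyTime.foldr_add (f := fun _ a => vecMax a) (by fun_prop) hA
  have hstep := (polyTime_scheduleStep (N := N)).comp'
    (f := fun y : (ι × (Fin N → ℕ)) × List (PartialSchedule N) => ((f y.1.1, y.1.2), y.2))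
    (by fun_prop)
  refine PolyTime.foldr (step := fun y a L => scheduleStep (f y) a L) hstep (by fun_prop) hA
    (g := fun y => 1 + ((f y).2 + 2) ^ N * (1 + (1 + (1 + N * (1 + esize ((f y).2 + 1))) +
      (1 + (1 + N * (1 + esize ((A y).foldr (fun a b => vecMax a + b) 0))) +
        (1 + esize (A y) * (1 + (1 + N)))))))
    ?_ fun y A' hA' => ?_
  · have h1 : PolyTime fun y => (f y).2 + 1 := by fun_prop
    exact (PolyBounded.const 1).add (((hf2.add (.const 2)).pow N).mul
      ((PolyBounded.const 1).add (((PolyBounded.const 1).add ((PolyBounded.const 1).add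
        ((PolyBounded.const N).mul ((PolyBounded.const 1).add h1.polyBounded)))).add
        (((PolyBounded.const 1).add ((PolyBounded.const 1).add ((PolyBounded.const N).mul
          ((PolyBounded.const 1).add hW.polyBounded)))).add
          ((PolyBounded.const 1).add (hA.polyBounded.mul (.const _)))))))
  · refine (esize_list_le _ _ fun s hs => ?_).trans
      (Nat.add_le_add_left (Nat.mul_le_mul_right _ (length_schedules_le (f y) A')) 1)
    have hsch : IsSchedule (f y) A' s := isSchedule_of_mem_schedules s hs
    have hmono : A'.foldr (fun a b => vecMax a + b) 0 ≤
        (A y).foldr (fun a b => vecMax a + b) 0 := by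
      obtain ⟨p, hp⟩ := hA'
      rw [← hp]
      clear hp
      induction p with
      | nil => rfl
      | cons a p ih => rw [List.cons_append, List.foldr_cons]; omega
    rw [esize_prod, esize_prod]
    refine Nat.add_le_add (Nat.add_le_add_left (esize_fun_le _ _ fun j => esize_nat_mono ?_) 1)
      (Nat.add_le_add (Nat.add_le_add_left (esize_fun_le _ _ fun j => esize_nat_mono ?_) 1)
        ((esize_list_le _ (1 + N) fun i _ => esize_fin_le i).trans
          (Nat.add_le_add_left (Nat.mul_le_mul_right _ ?_) 1)))
    · rw [hsch.key_eq]; exact min_le_left _ _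
    · rw [hsch.load_eq]; exact (listLoad_le_sum j A' _).trans hmono
    · rw [hsch.length_eq]; exact hA'.length_le.trans (length_le_esize _)

theorem PolyTime.approxSchedule [NeZero N] {ι : Type} [Enc ι] {A : ι → List (Fin N → ℕ)}
    {k : ι → ℕ} (hA : PolyTime A) (hk : PolyTime k) (hk' : PolyBounded k) :
    PolyTime fun y => approxSchedule (A y) (k y) := by
  refine polyTime_bestSchedule.comp' (PolyTime.schedules
    (polyTime_roundParams.comp' (hA.prodMk hk)) hA ?_)
  exact ((hA.polyBounded.mul (.const N)).mul hk').mono fun y =>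
    Nat.mul_le_mul_right _ (Nat.mul_le_mul_right _ (length_le_esize _))

end Semantics

/-! ### The approximation guarantee -/

section Guarantee

variable {N : ℕ} [NeZero N] {M : Type*} [Fintype M] [DecidableEq M]

omit [Fintype M] [DecidableEq M] in
theorem utility_neg (w : M → ℝ) (T : Finset M) : utility (-w) T = -utility w T := by
  simp [utility]

theorem minMaxShare_neg (w : M → ℝ) : minMaxShare N (-w) = -maxMinShare N w := by
  refine le_antisymm ?_ ?_
  · rw [le_neg]
    refine Finset.sup'_le _ _ fun S _ => ?_
    rw [le_neg]
    refine (Finset.inf'_le _ (mem_univ S)).trans (Finset.sup'_le _ _ fun i _ => ?_)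
    rw [utility_neg, neg_le_neg_iff]
    exact Finset.inf'_le _ (mem_univ i)
  · refine Finset.le_inf' _ _ fun S _ => ?_
    rw [neg_le]
    refine le_trans (Finset.le_inf' _ _ fun i _ => ?_) (Finset.le_sup' (fun S : Allocation N M =>
      univ.inf' univ_nonempty fun i : Fin N => utility w (S.bundle i)) (mem_univ S))
    rw [neg_le, ← utility_neg]
    exact Finset.le_sup' (fun i => utility (-w) (S.bundle i)) (mem_univ i)

omit [NeZero N] [Fintype M] [DecidableEq M] in
theorem utility_rescale (u : Utilities N M) (c : Fin N → ℝ) (i : Fin N) (T : Finset M) :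
    utility (rescale u c i) T = if 0 < c i then 1 / c i * utility (u i) T else 0 := by
  unfold utility rescale
  split_ifs with h
  · rw [Finset.mul_sum]
  · simp

/-- The allocation `T` shows that the rescaled optimum is at most `lam`; undoing the scaling for `S`
costs the factors `β` and `α`. -/
theorem IsAlgorithmRun.solvesMaxMin {d : Utilities N M} (hd : IsNonpositive d) {ε α β : ℝ}
    {c : Fin N → ℝ} {S : Allocation N M} (h : IsAlgorithmRun (-d) ε α β c S) {lam : ℝ}
    (hlam : 0 ≤ lam) {T : Allocation N M} (hT : SolvesMaxMin lam d T) :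
    SolvesMaxMin ((1 + ε) * lam) d S := by
  have hshare : ∀ i, minMaxShare N ((-d) i) = -maxMinShare N (d i) := fun i => minMaxShare_neg _
  have hutil : ∀ i X, utility ((-d) i) X = -utility (d i) X := fun i X => utility_neg _ _
  have hopt : optMakespan (rescale (-d) c) ≤ lam := by
    refine (Finset.inf'_le _ (mem_univ T)).trans (Finset.sup'_le _ _ fun i _ => ?_)
    rw [utility_rescale]
    split_ifs with hc
    · rw [one_div, inv_mul_le_iff₀ hc, hutil]
      have h1 := mul_le_mul_of_nonneg_left (h.share_le i) hlam
      have h2 := hT i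
      rw [hshare] at h1
      linarith
    · exact hlam
  intro i
  have h1 := h.share_le i
  have h2 := h.le_share i
  rw [hshare] at h1 h2
  have hnonpos := maxMinShare_nonpos_of_nonpos (N := N) (d i) (hd i)
  by_cases hc : 0 < c i
  · have h3 := h.schedule i
    rw [utility_rescale, if_pos hc, one_div, inv_mul_le_iff₀ hc, hutil] at h3
    have hβ : 0 < β := one_pos.trans h.one_lt_beta
    have h4 : c i * (β * optMakespan (rescale (-d) c)) ≤ c i * (β * lam) := by gcongr
    have h6 := mul_le_mul_of_nonneg_right h2 (mul_nonneg hβ.le hlam)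
    have h5 := mul_le_mul_of_nonneg_right h.mul_lt.le
      (mul_nonneg hlam (neg_nonneg.2 hnonpos))
    linarith
  -- If `c i` is not positive, the share vanishes, so agent `i` values every bundle at `0`.
  · have h0 : maxMinShare N (d i) = 0 := by linarith
    rw [h0, utility_eq_zero_of_maxMinShare_eq_zero (d i) (hd i) h0, mul_zero]

theorem IsAlgorithmRun.isApproxOptimalMmS {d : Utilities N M} (hd : IsNonpositive d)
    {ε α β : ℝ} {c : Fin N → ℝ} {S : Allocation N M} (h : IsAlgorithmRun (-d) ε α β c S) :
    IsApproxOptimalMmS ε d S :=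
  have ⟨h0, _, hT⟩ := (isLeast_optimalMmSRatio d hd).1
  h.solvesMaxMin hd h0 hT

theorem IsAlgorithmRun.isApproxMmS {d : Utilities N M} (hd : IsNonpositive d)
    {ε α β : ℝ} {c : Fin N → ℝ} {S : Allocation N M} (h : IsAlgorithmRun (-d) ε α β c S)
    (hA : ∃ A : Allocation N M, IsMmSAllocation d A) : IsApproxMmS ε d S := by
  obtain ⟨A, hA⟩ := hA
  have := h.solvesMaxMin hd zero_le_one (T := A) fun i => by rw [one_mul]; exact hA i
  rwa [mul_one] at this

end Guarantee

/-! ### Execution of the algorithm on rational instances -/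

section Execution

variable {N : ℕ} [NeZero N]

/-- A common denominator of all values. -/
def commonDen (d : List (Fin N → ℚ)) : ℕ :=
  d.foldr (fun a b => vecProd (fun i => (a i).den) * b) 1

/-- The absolute values of the items, multiplied by the common denominator. -/
def clearDen (d : List (Fin N → ℚ)) : List (Fin N → ℕ) :=
  d.map fun a i => (a i).num.natAbs * commonDen d / (a i).den

/-- The approximate min-max share of agent `i`. -/
def approxShare (A : List (Fin N → ℕ)) (k : ℕ) (i : Fin N) : ℕ :=
  vecMax (approxSchedule (N := N) (A.map fun a _ => a i) k).2.1

/-- The rescaled instance, multiplied by a common denominator. -/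
def rescaleTimes (v : Fin N → ℕ) (A : List (Fin N → ℕ)) : List (Fin N → ℕ) :=
  A.map fun a i => a i * vecProd (fun i => max (v i) 1) / v i

/-- The allocation, `α`, `β` and the approximate shares, as numerators and denominators. -/
def runAlgorithm (d : List (Fin N → ℚ)) (k : ℕ) :
    List (Fin N) × (ℕ × ℕ) × (ℕ × ℕ) × (Fin N → ℕ × ℕ) :=
  ((approxSchedule (rescaleTimes (approxShare (clearDen d) k) (clearDen d)) k).2.2,
    (k + 1, k), (k + 1, k), fun i => (approxShare (clearDen d) k i, commonDen d))

omit [NeZero N] in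
theorem polyTime_commonDen : PolyTime fun d : List (Fin N → ℚ) => commonDen d :=
  PolyTime.foldr_mul (f := fun _ (a : Fin N → ℚ) => vecProd fun i => (a i).den)
    (polyTime_vecProd (.pi fun i => PolyTime.rat_den.comp'
      (f := fun y : List (Fin N → ℚ) × (Fin N → ℚ) => y.2 i) (by fun_prop))) .id

omit [NeZero N] in
theorem polyTime_clearDen : PolyTime fun d : List (Fin N → ℚ) => clearDen d := by
  refine PolyTime.map (f := fun (d : List (Fin N → ℚ)) (a : Fin N → ℚ) (i : Fin N) =>
    (a i).num.natAbs * commonDen d / (a i).den)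
    (.pi fun i => ?_) .id
  have h0 : PolyTime fun y : List (Fin N → ℚ) × (Fin N → ℚ) => y.2 i := by fun_prop
  have h1 := PolyTime.rat_num_natAbs.comp' h0
  have h2 := PolyTime.rat_den.comp' h0
  have h3 := polyTime_commonDen.comp'
    (f := fun y : List (Fin N → ℚ) × (Fin N → ℚ) => y.1) (by fun_prop)
  exact (h1.mul h3).div h2

omit [NeZero N] in
theorem polyTime_rescaleTimes : PolyTime fun y : (Fin N → ℕ) × List (Fin N → ℕ) =>
    rescaleTimes y.1 y.2 := by
  refine PolyTime.map (f := fun (y : (Fin N → ℕ) × List (Fin N → ℕ)) (a : Fin N → ℕ) i =>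
    a i * vecProd (fun i => max (y.1 i) 1) / y.1 i) (.pi fun i => ?_) (by fun_prop)
  have h : PolyTime fun y : ((Fin N → ℕ) × List (Fin N → ℕ)) × (Fin N → ℕ) =>
    vecProd (fun i => max (y.1.1 i) 1) := polyTime_vecProd (.pi fun i => by fun_prop)
  fun_prop

/-- The accuracy is the length of a `List Unit`, so that its value is bounded by the input size, as
`PolyTime.approxSchedule` requires. -/
theorem polyTime_runAlgorithm :
    PolyTime fun y : List (Fin N → ℚ) × List Unit => runAlgorithm y.1 y.2.length := by
  have hk : PolyTime fun y : List (Fin N → ℚ) × List Unit => y.2.length :=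
    PolyTime.length (by fun_prop)
  have hk' : PolyBounded fun y : List (Fin N → ℚ) × List Unit => y.2.length :=
    PolyBounded.esize.mono fun y =>
      (length_le_esize _).trans (by rw [esize_prod]; exact Nat.le_add_left _ _)
  have hA : PolyTime fun y : List (Fin N → ℚ) × List Unit => clearDen y.1 :=
    polyTime_clearDen.comp' (by fun_prop)
  have hD : PolyTime fun y : List (Fin N → ℚ) × List Unit => commonDen y.1 :=
    polyTime_commonDen.comp' (by fun_prop)
  have hv : PolyTime fun y : List (Fin N → ℚ) × List Unit =>
      approxShare (clearDen y.1) y.2.length := by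
    refine .pi fun i => polyTime_vecMax (.fst (.snd (PolyTime.approxSchedule ?_ hk hk')))
    exact (PolyTime.map (ι := List (Fin N → ℕ)) (f := fun _ (a : Fin N → ℕ) (_ : Fin N) => a i)
      (.pi fun _ => by fun_prop) .id).comp' hA
  have hB := polyTime_rescaleTimes.comp' (hv.prodMk hA)
  have hS := (PolyTime.approxSchedule hB hk hk').snd.snd
  have hk1 : PolyTime fun y : List (Fin N → ℚ) × List Unit => y.2.length + 1 := by fun_prop
  exact hS.prodMk ((hk1.prodMk hk).prodMk ((hk1.prodMk hk).prodMk
    (.pi fun i => .prodMk ((PolyTime.apply i).comp' hv) hD)))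

omit [NeZero N] in
theorem listLoad_ofFn {m : ℕ} (a : Fin m → Fin N → ℕ) (S : Fin m → Fin N) (i : Fin N) :
    listLoad (List.ofFn a) (List.ofFn S) i = ∑ j, if S j = i then a j i else 0 := by
  induction m with
  | zero => simp [listLoad]
  | succ m ih => rw [List.ofFn_succ, List.ofFn_succ, listLoad, ih, Fin.sum_univ_succ]

theorem exists_ofFn_eq {α : Type*} {m : ℕ} {T : List α} (h : T.length = m) :
    ∃ S : Fin m → α, List.ofFn S = T := by
  subst h
  exact ⟨T.get, List.ofFn_get T⟩

/-- The computed schedule, for processing times that become integral after multiplication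
with `κ`. -/
theorem exists_allocation_approxSchedule {m k : ℕ} (hk : 0 < k) (p : Utilities N (Fin m))
    (a : Fin m → Fin N → ℕ) {κ : ℝ} (hκ : 0 < κ) (h : ∀ i j, p i j * κ = a j i) :
    ∃ S : Allocation N (Fin m), List.ofFn S = (approxSchedule (List.ofFn a) k).2.2 ∧
      (∀ i, utility (p i) (S.bundle i) ≤ vecMax (approxSchedule (List.ofFn a) k).2.1 / κ) ∧
      vecMax (approxSchedule (List.ofFn a) k).2.1 / κ ≤ (k + 1 : ℝ) / k * optMakespan p := by
  have hutil : ∀ (T : Allocation N (Fin m)) i,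
      utility (p i) (T.bundle i) = listLoad (List.ofFn a) (List.ofFn T) i / κ := by
    intro T i
    rw [eq_div_iff hκ.ne', listLoad_ofFn, utility, Allocation.bundle, Finset.sum_filter,
      Finset.sum_mul]
    push_cast
    refine Finset.sum_congr rfl fun j _ => ?_
    split_ifs
    · exact h i j
    · exact zero_mul _
  have hs := isSchedule_approxSchedule (List.ofFn a) k
  obtain ⟨S, hS⟩ := exists_ofFn_eq (m := m) (T := (approxSchedule (List.ofFn a) k).2.2)
    (by rw [hs.length_eq, List.length_ofFn])
  refine ⟨S, hS, fun i => ?_, ?_⟩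
  · rw [hutil, hS, ← hs.load_eq]
    have := le_vecMax (approxSchedule (List.ofFn a) k).2.1 i
    gcongr
  · obtain ⟨T, -, hT⟩ := Finset.exists_mem_eq_inf' (univ_nonempty (α := Allocation N (Fin m)))
      fun T : Allocation N (Fin m) =>
        univ.sup' univ_nonempty fun i : Fin N => utility (p i) (T.bundle i)
    have h1 := approxSchedule_le (List.ofFn a) k (List.ofFn T) (by simp)
    have h2 : (vecMax (listLoad (List.ofFn a) (List.ofFn T)) : ℝ) ≤ optMakespan p * κ := by
      rw [← div_le_iff₀ hκ]
      have h3 : ∃ i, vecMax (listLoad (List.ofFn a) (List.ofFn T)) ≤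
          listLoad (List.ofFn a) (List.ofFn T) i := by
        obtain ⟨i, -, hi⟩ := Finset.exists_max_image univ
          (listLoad (List.ofFn a) (List.ofFn T)) univ_nonempty
        exact ⟨i, vecMax_le_iff.2 fun j => hi j (mem_univ j)⟩
      obtain ⟨i, hi⟩ := h3
      have h4 : utility (p i) (T.bundle i) ≤ optMakespan p := by
        rw [optMakespan, hT]
        exact Finset.le_sup' (fun i => utility (p i) (T.bundle i)) (mem_univ i)
      rw [hutil] at h4
      refine le_trans ?_ h4
      gcongr
    have h3 : (vecMax (approxSchedule (List.ofFn a) k).2.1 : ℝ) * k ≤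
        (k + 1) * vecMax (listLoad (List.ofFn a) (List.ofFn T)) := by exact_mod_cast h1
    have hk' : (0 : ℝ) < k := by exact_mod_cast hk
    rw [div_le_iff₀ hκ, mul_assoc, div_mul_eq_mul_div, le_div_iff₀ hk']
    exact h3.trans (mul_le_mul_of_nonneg_left h2 (by positivity))

omit [NeZero N] in
theorem commonDen_pos (d : List (Fin N → ℚ)) : 0 < commonDen d := by
  unfold commonDen
  induction d with
  | nil => simp
  | cons a d ih => exact Nat.mul_pos (vecProd_pos fun i => (a i).den_pos) ih

omit [NeZero N] in
theorem den_dvd_commonDen {d : List (Fin N → ℚ)} {a : Fin N → ℚ} (ha : a ∈ d) (i : Fin N) :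
    (a i).den ∣ commonDen d := by
  unfold commonDen
  induction d with
  | nil => simp at ha
  | cons b d ih =>
    rcases List.mem_cons.1 ha with rfl | ha
    · exact (dvd_vecProd (fun i => (a i).den) i).mul_right _
    · exact (ih ha).mul_left _

theorem isAlgorithmRun_runAlgorithm {m k : ℕ} (hk : 0 < k) {ε : ℝ} (hε : 3 / ε < k)
    (hε0 : 0 < ε) (d : RatUtilities N m) (hd : IsNonpositive d.toReal) :
    ∃ S : Allocation N (Fin m),
      List.ofFn S = (runAlgorithm (List.ofFn fun j i => d i j) k).1 ∧
      IsAlgorithmRun (-d.toReal) ε ((k + 1 : ℝ) / k) ((k + 1 : ℝ) / k)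
        (fun i => (approxShare (clearDen (List.ofFn fun j i => d i j)) k i : ℝ) /
          commonDen (List.ofFn fun j i => d i j)) S := by
  set l : List (Fin N → ℚ) := List.ofFn fun j i => d i j with hl
  set D := commonDen l with hD
  have hDpos : (0 : ℝ) < D := by exact_mod_cast commonDen_pos l
  have hk' : (0 : ℝ) < k := by exact_mod_cast hk
  set a : Fin m → Fin N → ℕ := fun j i => (d i j).num.natAbs * D / (d i j).den with ha
  have hclear : clearDen l = List.ofFn a := by
    rw [clearDen, hl, List.map_ofFn]; rfl
  have hu : ∀ i j, (-d.toReal) i j * D = a j i := by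
    intro i j
    have h1 : (d i j).den ∣ (d i j).num.natAbs * D := by
      refine Dvd.dvd.mul_left ?_ _
      exact den_dvd_commonDen (a := fun i => d i j)
        ((List.mem_ofFn' _ _).2 ⟨j, rfl⟩) i
    have hden : ((d i j).den : ℝ) ≠ 0 := by exact_mod_cast (d i j).den_nz
    have hle : d i j ≤ 0 := by
      have := hd i j
      rw [RatUtilities.toReal] at this
      exact_mod_cast this
    have hnum : (((d i j).num.natAbs : ℕ) : ℝ) = -((d i j).num : ℝ) := by
      have h2 : (((d i j).num.natAbs : ℕ) : ℤ) = -(d i j).num := by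
        have := Rat.num_nonpos.2 hle
        omega
      rw [← Int.cast_natCast, h2, Int.cast_neg]
    rw [ha]
    simp only [Pi.neg_apply, RatUtilities.toReal]
    rw [Nat.cast_div h1 hden, Nat.cast_mul, hnum, Rat.cast_def]
    ring
  set v := approxShare (clearDen l) k with hv
  have hshare : ∀ i, minMaxShare N ((-d.toReal) i) ≤ (v i : ℝ) / D ∧
      (v i : ℝ) / D ≤ (k + 1 : ℝ) / k * minMaxShare N ((-d.toReal) i) := by
    intro i
    have h1 : v i = vecMax (approxSchedule (List.ofFn fun j (_ : Fin N) => a j i) k).2.1 := by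
      rw [hv, approxShare, hclear, List.map_ofFn]; rfl
    obtain ⟨S, -, h2, h3⟩ := exists_allocation_approxSchedule hk
      (fun (_ : Fin N) => (-d.toReal) i) (fun j _ => a j i) hDpos fun _ j => hu i j
    rw [h1]
    -- The computed number bounds all loads of an actual partition, hence lies above the min-max
    -- share; the upper bound is the quality of the scheme on identical machines.
    exact ⟨(Finset.inf'_le _ (mem_univ S)).trans (Finset.sup'_le _ _ fun i' _ => h2 i'), h3⟩
  set V := vecProd (fun i => max (v i) 1) with hV
  have hVpos : (0 : ℝ) < V := by
    exact_mod_cast vecProd_pos fun i => by omega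
  have hresc : ∀ i j, rescale (-d.toReal) (fun i => (v i : ℝ) / D) i j * V =
      ((a j i * V / v i : ℕ) : ℝ) := by
    intro i j
    rcases Nat.eq_zero_or_pos (v i) with h0 | h0
    -- Division by `0` in `ℕ` gives `0`, in agreement with the rescaling for a vanishing share.
    · simp [rescale, h0]
    · have h1 : (0 : ℝ) < v i := by exact_mod_cast h0
      -- The common denominator `D` cancels in the quotient of value and share, so `V` alone makes
      -- the rescaled times integral; the maxima with `1` only keep `V` positive.
      have h2 : v i ∣ a j i * V := by
        refine Dvd.dvd.mul_left ?_ _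
        have := dvd_vecProd (fun i => max (v i) 1) i
        rwa [show max (v i) 1 = v i from max_eq_left h0] at this
      rw [rescale, if_pos (div_pos h1 hDpos), Nat.cast_div h2 h1.ne', Nat.cast_mul, ← hu i j]
      field_simp
  obtain ⟨S, hS, h2, h3⟩ := exists_allocation_approxSchedule hk
    (rescale (-d.toReal) (fun i => (v i : ℝ) / D)) (fun j i => a j i * V / v i) hVpos hresc
  have hone : 1 < (k + 1 : ℝ) / k := by rw [lt_div_iff₀ hk']; linarith
  refine ⟨S, ?_, hone, hone, ?_, fun i => (hshare i).1, fun i => (hshare i).2,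
    fun i => (h2 i).trans h3⟩
  · rw [hS, runAlgorithm, rescaleTimes, ← hv, hclear, List.map_ofFn]
    rfl
  · rw [div_lt_iff₀ hε0] at hε
    -- The claim is `(k + 1) ^ 2 < (1 + ε) * k ^ 2`, which follows from `2 * k + 1 ≤ 3 * k < ε * k ^
    -- 2`.
    have h1 : (1 : ℝ) ≤ k := by exact_mod_cast hk
    rw [div_mul_div_comm, div_lt_iff₀ (by positivity)]
    nlinarith

/-! #### The program -/

/-- Conversion from binary to unary by counting down. Its time may be exponential in the size of
`q`; only halting is claimed. -/
theorem exists_program_replicate (f : ℚ → ℕ) (hf : PolyTime f) : ∃ P : Program, ∀ q : ℚ,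
    ∃ t, P.Runs (enc q) (enc (List.replicate (f q) ())) t := by
  have hstart : PolyTime fun q => (f q, ([] : List Unit)) := by fun_prop
  have hend : PolyTime fun y : ℕ × List Unit => y.2 := by fun_prop
  obtain ⟨P, _, hP⟩ := hstart
  obtain ⟨Q, _, hQ⟩ := hend
  have hloop : ∀ (n : ℕ) (l : List Unit), ∃ t,
      (Program.loop (.prim .fst) (.pair (.seq (.pair (.prim .fst) (.prim (.const 1))) (.prim .sub))
        (.pair (.prim (.const 0)) (.prim .snd)))).Runs (enc (n, l))
          (enc (0, List.replicate n () ++ l)) t := by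
    intro n
    induction n with
    | zero => exact fun l => ⟨_, .loop_done (.prim .fst (enc (0, l)))⟩
    | succ n ih =>
      intro l
      obtain ⟨t, ht⟩ := ih (() :: l)
      have h1 : List.replicate n () ++ () :: l = List.replicate (n + 1) () ++ l := by
        rw [List.replicate_succ', List.append_assoc]; rfl
      rw [h1] at ht
      have hbody := Program.Runs.pair
        (Program.Runs.seq (Program.Runs.pair (Program.Runs.prim .fst (enc (n + 1, l)))
          (Program.Runs.prim (.const 1) (enc (n + 1, l)))) (Program.Runs.prim .sub _))
        (Program.Runs.pair (Program.Runs.prim (.const 0) (enc (n + 1, l)))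
          (Program.Runs.prim .snd (enc (n + 1, l))))
      have h2 : Data.pair (Primitive.eval .sub (.pair (Primitive.eval .fst (enc (n + 1, l)))
          (Primitive.eval (.const 1) (enc (n + 1, l)))))
          (.pair (Primitive.eval (.const 0) (enc (n + 1, l)))
            (Primitive.eval .snd (enc (n + 1, l)))) = enc (n, () :: l) := by
        simp [Primitive.eval, enc, Data.fst, Data.snd, Data.toInt, Data.ofList]
      rw [h2] at hbody
      refine ⟨_, .loop_step (.prim .fst (enc (n + 1, l))) ?_ hbody ht⟩
      simp only [Primitive.eval, enc, Data.fst, ne_eq, Data.int.injEq]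
      omega
  refine ⟨.seq P (.seq (.loop (.prim .fst) (.pair (.seq (.pair (.prim .fst) (.prim (.const 1)))
    (.prim .sub)) (.pair (.prim (.const 0)) (.prim .snd)))) Q), fun q => ?_⟩
  obtain ⟨s, hs, -⟩ := hP q
  obtain ⟨t, ht⟩ := hloop (f q) []
  obtain ⟨r, hr, -⟩ := hQ (0, List.replicate (f q) () ++ [])
  rw [List.append_nil] at ht hr
  exact ⟨_, .seq hs (.seq ht hr)⟩

/-- The accuracy parameter: the scheduling problems are solved up to the factor `1 + 1 / k`. -/
def accuracy (q : ℚ) : ℕ := 3 * q.den / q.num.natAbs + 1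

theorem lt_accuracy {q : ℚ} (hq : 0 < q) : 3 / (q : ℝ) < accuracy q := by
  have hnum : 0 < q.num := Rat.num_pos.2 hq
  have h1 : 3 * q.den < accuracy q * q.num.natAbs := by
    rw [accuracy, mul_comm _ q.num.natAbs]
    exact Nat.lt_mul_div_succ _ (Int.natAbs_pos.2 hnum.ne')
  have h2 : ((q.num.natAbs : ℕ) : ℝ) = (q.num : ℝ) := by
    rw [Nat.cast_natAbs, abs_of_pos hnum]
  have h3 : (3 : ℝ) * q.den < accuracy q * q.num := by rw [← h2]; exact_mod_cast h1
  rw [div_lt_iff₀ (by exact_mod_cast hq), Rat.cast_def, mul_div_assoc',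
    lt_div_iff₀ (by exact_mod_cast q.den_pos)]
  exact h3

theorem polyTime_accuracy : PolyTime accuracy :=
  (((PolyTime.const 3).mul PolyTime.rat_den).div PolyTime.rat_num_natAbs).add (.const 1)

omit [NeZero N] in
theorem RatUtilities.encode_eq {m : ℕ} (d : RatUtilities N m) :
    d.encode = enc (List.ofFn fun j i => d i j) := by
  simp only [enc, List.map_ofFn, RatUtilities.encode]
  rfl

omit [NeZero N] in
theorem Allocation.encode_eq {m : ℕ} (S : Allocation N (Fin m)) :
    S.encode = enc (List.ofFn S) := by
  simp only [enc, List.map_ofFn, Allocation.encode]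
  rfl

/-- One program works for all `ε`, whereas the polynomial depends on `ε`. -/
theorem exists_program_runAlgorithm (N : ℕ) [NeZero N] : ∃ P : Program, ∀ ε : ℚ,
    ∃ p : Polynomial ℕ, ∀ (m : ℕ) (d : RatUtilities N m), ∃ t,
      P.Runs (.pair d.encode (.ofRat ε))
        (enc (runAlgorithm (List.ofFn fun j i => d i j) (accuracy ε))) t ∧
      t ≤ p.eval d.encode.size := by
  obtain ⟨U, hU⟩ := exists_program_replicate accuracy polyTime_accuracy
  obtain ⟨Q, c, hQ⟩ := polyTime_runAlgorithm (N := N)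
  refine ⟨.seq (.pair (.prim .fst) (.seq (.prim .snd) U)) Q, fun ε => ?_⟩
  -- The time `s` of the unary conversion also bounds the size of its result, and is a constant once
  -- `ε` is fixed.
  obtain ⟨s, hs⟩ := hU ε
  have hsize := hs.size_le
  refine ⟨(2 * Polynomial.X + Polynomial.C (1 + (1 + 1 + (Data.ofRat ε).size) +
    (1 + (1 + 1 + (Data.ofRat ε).size + (Data.ofRat ε).size) + s)) + Polynomial.X + 1) +
      (Polynomial.X + Polynomial.C (2 + s)) ^ c, fun m d => ?_⟩
  obtain ⟨t, h1, h2⟩ := hQ (List.ofFn fun j i => d i j, List.replicate (accuracy ε) ())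
  simp only [List.length_replicate] at h1
  rw [RatUtilities.encode_eq]
  refine ⟨_, .seq (.pair (.prim .fst _) (.seq (.prim .snd _) hs)) h1, ?_⟩
  have h3 : esize ((List.ofFn fun j i => d i j, List.replicate (accuracy ε) ()) :
      List (Fin N → ℚ) × List Unit) + 1 ≤
      (enc (List.ofFn fun j i => d i j)).size + (2 + s) := by
    rw [esize_prod]
    have : esize (List.replicate (accuracy ε) ()) ≤ s := hsize.2
    simp only [esize] at this ⊢
    omega
  have h4 := h2.trans (Nat.pow_le_pow_left h3 c)
  simp only [Polynomial.eval_add, Polynomial.eval_mul, Polynomial.eval_X, Polynomial.eval_pow,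
    Polynomial.eval_C, Polynomial.eval_one, Polynomial.eval_ofNat]
  refine Nat.add_le_add ?_ h4
  simp only [Primitive.eval, Data.size, Data.fst, Data.snd]
  omega

end Execution

theorem mainTheorem4 (N : ℕ) [NeZero N] :
    (∀ (M : Type*) [Fintype M] [DecidableEq M] (d : Utilities N M), IsNonpositive d →
      ∀ (ε : ℝ), 0 < ε → ∀ (α β : ℝ) (c : Fin N → ℝ) (S : Allocation N M),
        IsAlgorithmRun (-d) ε α β c S →
          IsApproxOptimalMmS ε d S ∧
          ((∃ A : Allocation N M, IsMmSAllocation d A) → IsApproxMmS ε d S)) ∧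
    ∃ P : Program,
      ExecutesAlgorithm N P ∧
      IsPTAS N P (fun _ => True) (fun ε d S => IsApproxOptimalMmS ε d S) ∧
      IsPTAS N P (fun d => ∃ A, IsMmSAllocation d A) (fun ε d S => IsApproxMmS ε d S) := by
  refine ⟨fun M _ _ d hd ε _ α β c S h =>
    ⟨h.isApproxOptimalMmS hd, h.isApproxMmS hd⟩, ?_⟩
  obtain ⟨P, hP⟩ := exists_program_runAlgorithm N
  have hrun := fun (ε : ℚ) (hε : 0 < ε) (m : ℕ) (d : RatUtilities N m)
      (hd : IsNonpositive d.toReal) =>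
    isAlgorithmRun_runAlgorithm (k := accuracy ε) (Nat.succ_pos _) (lt_accuracy hε)
      (by exact_mod_cast hε) d hd
  have hout : ∀ (ε : ℚ) (m : ℕ) (d : RatUtilities N m) (S : Allocation N (Fin m)),
      List.ofFn S = (runAlgorithm (List.ofFn fun j i => d i j) (accuracy ε)).1 →
      enc (runAlgorithm (List.ofFn fun j i => d i j) (accuracy ε)) = .pair S.encode
        (enc (runAlgorithm (List.ofFn fun j i => d i j) (accuracy ε)).2) := by
    intro ε m d S hS
    rw [Allocation.encode_eq, hS]
    rfl
  refine ⟨P, fun ε hε m d hd => ?_, fun ε hε => ?_, fun ε hε => ?_⟩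
  · obtain ⟨S, hS, hS'⟩ := hrun ε hε m d hd
    obtain ⟨p, hp⟩ := hP ε
    obtain ⟨t, ht, -⟩ := hp m d
    rw [hout ε m d S hS] at ht
    refine ⟨S, _, _, _, t, ht, ?_⟩
    convert hS' using 2 <;>
      simp [runAlgorithm, Data.toRat, enc, Data.fst, Data.snd, Data.toInt]
  · obtain ⟨p, hp⟩ := hP ε
    refine ⟨p, fun m d hd _ => ?_⟩
    obtain ⟨S, hS, hS'⟩ := hrun ε hε m d hd
    obtain ⟨t, ht, hle⟩ := hp m d
    rw [hout ε m d S hS] at ht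
    exact ⟨S, _, t, ht, hle, hS'.isApproxOptimalMmS hd⟩
  · obtain ⟨p, hp⟩ := hP ε
    refine ⟨p, fun m d hd hA => ?_⟩
    obtain ⟨S, hS, hS'⟩ := hrun ε hε m d hd
    obtain ⟨t, ht, hle⟩ := hp m d
    rw [hout ε m d S hS] at ht
    exact ⟨S, _, t, ht, hle, hS'.isApproxMmS hd hA⟩
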